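/- **Theorem.** Work over $\mathbb{C}$. Let $\Gamma$ be an additive subgroup of $\mathbb{C}^2$ that is nondegenerate, i.e. contains a $\mathbb{C}$-basis of $\mathbb{C}^2$. Let $\mathcal{L}=\mathcal{L}(\Gamma)$ be the Lie algebra with basis $\{L_\alpha : \alpha\in\Gamma\setminus\{0\}\}\cup\{\partial_1,\partial_2\}$ and bracket $$[L_\alpha,L_\beta]=(\alpha_1\beta_2-\beta_1\alpha_2)L_{\alpha+\beta},\qquad [\partial_i,L_\alpha]=\alpha_iL_\alpha,\qquad [\partial_1,\partial_2]=0,$$ where $\alpha=(\alpha_1,\alpha_2)$, $\beta=(\beta_1,\beta_2)$ and $L_0:=0$. Let $\mathcal{L}$ act on $\mathcal{L}\otimes\mathcal{L}$ by $x\cdot(a\otimes b)=[x,a]\otimes b+a\otimes[x,b]$, and on threefold tensor products by the analogous diagonal adjoint action. Put $\tau(x\otimes y)=y\otimes x$ and $\xi(x\otimes y\otimes z)=y\otimes z\otimes x$. For $r=\sum_i a_i\otimes b_i\in\mathcal{L}\otimes\mathcal{L}$ put $$c(r)=[r^{12},r^{13}]+[r^{12},r^{23}]+[r^{13},r^{23}],$$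 the commutators being taken in $\mathcal{U}(\mathcal{L})^{\otimes 3}$, where $\mathcal{U}(\mathcal{L})$ is the universal enveloping algebra, $r^{12}=\sum_i a_i\otimes b_i\otimes 1$, $r^{13}=\sum_i a_i\otimes 1\otimes b_i$ and $r^{23}=\sum_i 1\otimes a_i\otimes b_i$. 1. Every Lie bialgebra structure on the Lie algebra $\mathcal{L}$ is triangular coboundary. That is, let $\Delta:\mathcal{L}\to\mathcal{L}\otimes\mathcal{L}$ be a linear map with $\operatorname{Im}\Delta\subset\operatorname{Im}(1-\tau)$, with $(1+\xi+\xi^2)(1\otimes\Delta)\Delta=0$, and with $\Delta([x,y])=x\cdot\Delta(y)-y\cdot\Delta(x)$ for all $x,y\in\mathcal{L}$. Then there is $r\in\operatorname{Im}(1-\tau)$ such that $\Delta(x)=x\cdot r$ for all $x\in\mathcal{L}$ and $c(r)=0$. 2. An element $r\in\mathcal{L}\otimes\mathcal{L}$ satisfies the classical Yang–Baxter equation $c(r)=0$ if and only if it satisfies the modified Yang–Baxter equation $x\cdot c(r)=0$ for all $x\in\mathcal{L}$. 3. Let $V=\mathcal{L}\otimes\mathcal{L}$. Then $H^1(\mathcal{L},V)=\operatorname{Der}(\mathcal{L},V)/\operatorname{Inn}(\mathcal{L},V)=0$,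 where $\operatorname{Der}(\mathcal{L},V)$ is the space of linear maps $D:\mathcal{L}\to V$ with $D([x,y])=x\cdot D(y)-y\cdot D(x)$ for all $x,y\in\mathcal{L}$, and $\operatorname{Inn}(\mathcal{L},V)$ is the space of maps $x\mapsto x\cdot v$ with $v\in V$. In other words, every such derivation is inner. -/

import Mathlib

open scoped TensorProduct

noncomputable section

/-! ### Lie bialgebras -/

namespace LieBialg

section General

variable (L : Type*) [LieRing L] [LieAlgebra ℂ L]

/-- The twist map `τ : x ⊗ y ↦ y ⊗ x`. -/
def twist : L ⊗[ℂ] L →ₗ[ℂ] L ⊗[ℂ] L :=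
  (TensorProduct.comm ℂ L L).toLinearMap

/-- The cyclic map `ξ : x ⊗ y ⊗ z ↦ y ⊗ z ⊗ x`. -/
def cyclic : L ⊗[ℂ] (L ⊗[ℂ] L) →ₗ[ℂ] L ⊗[ℂ] (L ⊗[ℂ] L) :=
  (TensorProduct.assoc ℂ L L L).toLinearMap ∘ₗ (TensorProduct.comm ℂ L (L ⊗[ℂ] L)).toLinearMap

theorem twist_tmul (x y : L) : twist L (x ⊗ₜ y) = y ⊗ₜ x := rfl

theorem cyclic_tmul (x y z : L) : cyclic L (x ⊗ₜ (y ⊗ₜ z)) = y ⊗ₜ (z ⊗ₜ x) := rfl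

/-- The subspace `Im (1 - τ)` of `L ⊗ L`. -/
def skewTensors : Submodule ℂ (L ⊗[ℂ] L) :=
  LinearMap.range (LinearMap.id - twist L)

variable {L}

/-- `(L, Δ)` is a Lie coalgebra: anti-commutativity and the dual Jacobi identity. -/
structure IsLieCoalgebra (Δ : L →ₗ[ℂ] L ⊗[ℂ] L) : Prop where
  anticomm : LinearMap.range Δ ≤ skewTensors L
  jacobi : (LinearMap.id + cyclic L + cyclic L ∘ₗ cyclic L) ∘ₗ LinearMap.lTensor L Δ ∘ₗ Δ = 0

/-- `Δ` is the cobracket of a Lie bialgebra structure on the Lie algebra `L`. Here `⁅x, v⁆` for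
`x : L` and `v : L ⊗ L` is the diagonal adjoint action
`x · (a ⊗ b) = ⁅x, a⁆ ⊗ b + a ⊗ ⁅x, b⁆`. -/
structure IsLieBialgebra (Δ : L →ₗ[ℂ] L ⊗[ℂ] L) : Prop extends IsLieCoalgebra Δ where
  compat : ∀ x y : L, Δ ⁅x, y⁆ = ⁅x, Δ y⁆ - ⁅y, Δ x⁆

/-- The coboundary `Δ_r : x ↦ x · r` of `r ∈ L ⊗ L`. -/
def coboundary (r : L ⊗[ℂ] L) : L →ₗ[ℂ] L ⊗[ℂ] L :=
  (LieModule.toEnd ℂ L (L ⊗[ℂ] L) : L →ₗ[ℂ] Module.End ℂ (L ⊗[ℂ] L)).flip r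

theorem coboundary_apply (r : L ⊗[ℂ] L) (x : L) : coboundary r x = ⁅x, r⁆ := rfl

end General

section YangBaxter

attribute [local instance] LieRing.ofAssociativeRing LieAlgebra.ofAssociativeAlgebra

variable {L : Type*} [LieRing L] [LieAlgebra ℂ L]

/-- The universal enveloping algebra `𝒰(L)`. -/
abbrev Env (L : Type*) [LieRing L] [LieAlgebra ℂ L] : Type _ := UniversalEnvelopingAlgebra ℂ L

/-- The algebra `𝒰(L) ⊗ 𝒰(L) ⊗ 𝒰(L)`. -/
abbrev Env3 (L : Type*) [LieRing L] [LieAlgebra ℂ L] : Type _ :=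
  Env L ⊗[ℂ] (Env L ⊗[ℂ] Env L)

/-- The canonical map `L → 𝒰(L)`, as a linear map. -/
def incl (L : Type*) [LieRing L] [LieAlgebra ℂ L] : L →ₗ[ℂ] Env L :=
  (UniversalEnvelopingAlgebra.ι ℂ : L →ₗ⁅ℂ⁆ UniversalEnvelopingAlgebra ℂ L)

/-- `r ↦ r¹²`, that is `a ⊗ b ↦ a ⊗ b ⊗ 1`. -/
def r12 : L ⊗[ℂ] L →ₗ[ℂ] Env3 L :=
  TensorProduct.map (incl L) ((TensorProduct.mk ℂ (Env L) (Env L)).flip 1 ∘ₗ incl L)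

/-- `r ↦ r¹³`, that is `a ⊗ b ↦ a ⊗ 1 ⊗ b`. -/
def r13 : L ⊗[ℂ] L →ₗ[ℂ] Env3 L :=
  TensorProduct.map (incl L) (TensorProduct.mk ℂ (Env L) (Env L) 1 ∘ₗ incl L)

/-- `r ↦ r²³`, that is `a ⊗ b ↦ 1 ⊗ a ⊗ b`. -/
def r23 : L ⊗[ℂ] L →ₗ[ℂ] Env3 L :=
  TensorProduct.mk ℂ (Env L) (Env L ⊗[ℂ] Env L) 1 ∘ₗ TensorProduct.map (incl L) (incl L)

theorem r12_tmul (a b : L) :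
    r12 (a ⊗ₜ[ℂ] b) = incl L a ⊗ₜ[ℂ] (incl L b ⊗ₜ[ℂ] (1 : Env L)) := rfl

theorem r13_tmul (a b : L) :
    r13 (a ⊗ₜ[ℂ] b) = incl L a ⊗ₜ[ℂ] ((1 : Env L) ⊗ₜ[ℂ] incl L b) := rfl

theorem r23_tmul (a b : L) :
    r23 (a ⊗ₜ[ℂ] b) = (1 : Env L) ⊗ₜ[ℂ] (incl L a ⊗ₜ[ℂ] incl L b) := rfl

/-- The commutator `s t - t s` in the associative algebra `𝒰(L) ⊗ 𝒰(L) ⊗ 𝒰(L)`. -/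
def comm3 (s t : Env3 L) : Env3 L := s * t - t * s

/-- `c(r) = [r¹², r¹³] + [r¹², r²³] + [r¹³, r²³]`. -/
def c (r : L ⊗[ℂ] L) : Env3 L :=
  comm3 (r12 r) (r13 r) + comm3 (r12 r) (r23 r) + comm3 (r13 r) (r23 r)

/-- The adjoint action `u ↦ x u - u x` of `x ∈ L` on `𝒰(L)`; it extends `ad x` on `L`. -/
def adEnv (x : L) : Env L →ₗ[ℂ] Env L :=
  LinearMap.mulLeft ℂ (incl L x) - LinearMap.mulRight ℂ (incl L x)

theorem adEnv_incl (x y : L) : adEnv x (incl L y) = incl L ⁅x, y⁆ := by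
  simp [adEnv, incl, LieRing.of_associative_ring_bracket]

/-- The diagonal adjoint action
`x · (u ⊗ v ⊗ w) = [x, u] ⊗ v ⊗ w + u ⊗ [x, v] ⊗ w + u ⊗ v ⊗ [x, w]` of `L`. -/
def diagAct (x : L) : Env3 L →ₗ[ℂ] Env3 L :=
  TensorProduct.map (adEnv x) LinearMap.id
    + TensorProduct.map LinearMap.id
        (TensorProduct.map (adEnv x) LinearMap.id + TensorProduct.map LinearMap.id (adEnv x))

theorem diagAct_tmul (x : L) (u v w : Env L) :
    diagAct x (u ⊗ₜ (v ⊗ₜ w))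
      = adEnv x u ⊗ₜ (v ⊗ₜ w) + (u ⊗ₜ (adEnv x v ⊗ₜ w) + u ⊗ₜ (v ⊗ₜ adEnv x w)) := by
  simp [diagAct, TensorProduct.tmul_add]

/-- The classical Yang-Baxter equation `c(r) = 0`. -/
def CYBE (r : L ⊗[ℂ] L) : Prop := c r = 0

/-- The modified Yang-Baxter equation `x · c(r) = 0` for all `x ∈ L`. -/
def MYBE (r : L ⊗[ℂ] L) : Prop := ∀ x : L, diagAct x (c r) = 0

/-- `(L, [·,·], Δ, r)` is a coboundary Lie bialgebra. -/
structure IsCoboundary (Δ : L →ₗ[ℂ] L ⊗[ℂ] L) (r : L ⊗[ℂ] L) : Prop extends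
    IsLieBialgebra Δ where
  skew : r ∈ skewTensors L
  eq_coboundary : Δ = coboundary r

/-- `(L, [·,·], Δ, r)` is a triangular coboundary Lie bialgebra. -/
structure IsTriangular (Δ : L →ₗ[ℂ] L ⊗[ℂ] L) (r : L ⊗[ℂ] L) : Prop extends
    IsCoboundary Δ r where
  cybe : CYBE r

end YangBaxter

/-- The first cohomology `H¹(L, V) = Der(L, V) / Inn(L, V)`: linear maps `d : L → V` with
`d ⁅x, y⁆ = x · d y - y · d x`, modulo the maps `x ↦ x · v`. -/
abbrev H1 (L V : Type*) [LieRing L] [LieAlgebra ℂ L] [AddCommGroup V] [Module ℂ V]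
    [LieRingModule L V] [LieModule ℂ L V] : Type _ :=
  LieDerivation ℂ L V ⧸ LinearMap.range (LieDerivation.inner ℂ L V)

end LieBialg

/-! ### The generalized Virasoro-like algebras -/

/-- An additive subgroup of `ℂ²` is nondegenerate if it contains a `ℂ`-basis of `ℂ²`. -/
def Nondegenerate (Γ : AddSubgroup (Fin 2 → ℂ)) : Prop :=
  ∃ b : Module.Basis (Fin 2) ℂ (Fin 2 → ℂ), ∀ i, b i ∈ Γ

/-- The generalized Virasoro-like algebra: the vector space with basis
`L_α` (`α ∈ Γ \ {0}`), `∂₁`, `∂₂`. -/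
def GVir (Γ : AddSubgroup (Fin 2 → ℂ)) : Type :=
  ({α : Γ // α ≠ 0} ⊕ Fin 2) →₀ ℂ

namespace GVir

variable {Γ : AddSubgroup (Fin 2 → ℂ)}

instance : AddCommGroup (GVir Γ) :=
  inferInstanceAs (AddCommGroup (({α : Γ // α ≠ 0} ⊕ Fin 2) →₀ ℂ))

instance : Module ℂ (GVir Γ) :=
  inferInstanceAs (Module ℂ (({α : Γ // α ≠ 0} ⊕ Fin 2) →₀ ℂ))

/-- The defining basis: `inl α` indexes `L_α`, and `inr 0`, `inr 1` index `∂₁`, `∂₂`. -/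
def basis (Γ : AddSubgroup (Fin 2 → ℂ)) :
    Module.Basis ({α : Γ // α ≠ 0} ⊕ Fin 2) ℂ (GVir Γ) :=
  Module.Basis.ofRepr (LinearEquiv.refl ℂ (({α : Γ // α ≠ 0} ⊕ Fin 2) →₀ ℂ))

open Classical in
/-- The element `L_α` for `α ∈ Γ`, with the convention `L_0 = 0`. -/
def L (α : Γ) : GVir Γ :=
  if h : α ≠ 0 then basis Γ (Sum.inl ⟨α, h⟩) else 0

/-- The elements `∂₁ = d 0` and `∂₂ = d 1`. -/
def d (i : Fin 2) : GVir Γ := basis Γ (Sum.inr i)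

/-- `α₁ β₂ - β₁ α₂`. -/
def det (α β : Γ) : ℂ := α.1 0 * β.1 1 - β.1 0 * α.1 1

/-- The bracket of two basis vectors. -/
def brBasis : ({α : Γ // α ≠ 0} ⊕ Fin 2) → ({α : Γ // α ≠ 0} ⊕ Fin 2) → GVir Γ
  | .inl α, .inl β => det α.1 β.1 • L (α.1 + β.1)
  | .inr i, .inl β => (β.1 : Fin 2 → ℂ) i • L β.1
  | .inl α, .inr i => -((α.1 : Fin 2 → ℂ) i • L α.1)
  | .inr _, .inr _ => 0

/-- The bracket, extended bilinearly. -/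
def br (Γ : AddSubgroup (Fin 2 → ℂ)) : GVir Γ →ₗ[ℂ] GVir Γ →ₗ[ℂ] GVir Γ :=
  (basis Γ).constr ℂ fun i => (basis Γ).constr ℂ fun j => brBasis i j

theorem L_zero : L (0 : Γ) = 0 := by simp [L]

theorem basis_inl (α : {α : Γ // α ≠ 0}) : basis Γ (Sum.inl α) = L α.1 := by
  simp [L, α.2]

theorem basis_inr (i : Fin 2) : basis Γ (Sum.inr i) = d i := rfl

theorem br_L_L (α β : Γ) : br Γ (L α) (L β) = det α β • L (α + β) := by
  by_cases ha : α = 0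
  · subst ha; simp [L_zero, det]
  by_cases hb : β = 0
  · subst hb; simp [L_zero, det]
  rw [← basis_inl ⟨α, ha⟩, ← basis_inl ⟨β, hb⟩]
  simp [br, Module.Basis.constr_basis, brBasis]

theorem br_d_L (i : Fin 2) (β : Γ) : br Γ (d i) (L β) = (β : Fin 2 → ℂ) i • L β := by
  by_cases hb : β = 0
  · subst hb; simp [L_zero]
  rw [← basis_inl ⟨β, hb⟩, ← basis_inr]
  simp only [br, Module.Basis.constr_basis, brBasis]
  rw [basis_inl]

theorem br_L_d (α : Γ) (i : Fin 2) : br Γ (L α) (d i) = -((α : Fin 2 → ℂ) i • L α) := by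
  by_cases ha : α = 0
  · subst ha; simp [L_zero]
  rw [← basis_inl ⟨α, ha⟩, ← basis_inr]
  simp only [br, Module.Basis.constr_basis, brBasis]
  rw [basis_inl]

theorem br_d_d (i j : Fin 2) : br Γ (d i) (d j) = 0 := by
  rw [← basis_inr, ← basis_inr]
  simp only [br, Module.Basis.constr_basis, brBasis]

theorem br_swap (x y : GVir Γ) : br Γ x y = -br Γ y x := by
  have h : br Γ = -(br Γ).flip := by
    refine (basis Γ).ext fun i => (basis Γ).ext fun j => ?_
    rcases i with α | i <;> rcases j with β | j <;>
      simp only [basis_inl, basis_inr, LinearMap.neg_apply, LinearMap.flip_apply, br_L_L, br_L_d,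
        br_d_L, br_d_d, neg_neg, neg_zero]
    rw [add_comm β.1 α.1, ← neg_smul]
    congr 1
    simp only [det]; ring
  exact congrArg (fun f => f x y) h

theorem br_self (x : GVir Γ) : br Γ x x = 0 := by
  have h := br_swap x x
  have h2 : (2 : ℂ) • br Γ x x = 0 := by
    rw [two_smul]; nth_rewrite 1 [h]; simp
  exact (smul_eq_zero.mp h2).resolve_left two_ne_zero

theorem br_jacobi_basis (i j k : {α : Γ // α ≠ 0} ⊕ Fin 2) :
    br Γ (basis Γ i) (br Γ (basis Γ j) (basis Γ k))
      = br Γ (br Γ (basis Γ i) (basis Γ j)) (basis Γ k)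
        + br Γ (basis Γ j) (br Γ (basis Γ i) (basis Γ k)) := by
  rcases i with α | i <;> rcases j with β | j <;> rcases k with γ | k <;>
    simp only [basis_inl, basis_inr, br_L_L, br_L_d, br_d_L, br_d_d, map_smul, map_neg, map_zero,
      LinearMap.smul_apply, LinearMap.neg_apply, LinearMap.zero_apply, smul_smul, add_assoc,
      det, AddSubgroup.coe_add, Pi.add_apply]
  · rw [add_left_comm β.1 α.1 γ.1]; module
  · rw [add_comm β.1 α.1]; module
  all_goals module

theorem br_jacobi (x y z : GVir Γ) :
    br Γ x (br Γ y z) = br Γ (br Γ x y) z + br Γ y (br Γ x z) := by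
  have h1 : ∀ i j z, br Γ (basis Γ i) (br Γ (basis Γ j) z)
      = br Γ (br Γ (basis Γ i) (basis Γ j)) z + br Γ (basis Γ j) (br Γ (basis Γ i) z) := by
    intro i j z
    have h : br Γ (basis Γ i) ∘ₗ br Γ (basis Γ j)
        = br Γ (br Γ (basis Γ i) (basis Γ j)) + br Γ (basis Γ j) ∘ₗ br Γ (basis Γ i) :=
      (basis Γ).ext fun k => br_jacobi_basis i j k
    exact congrArg (fun f => f z) h
  have h2 : ∀ i y z, br Γ (basis Γ i) (br Γ y z)
      = br Γ (br Γ (basis Γ i) y) z + br Γ y (br Γ (basis Γ i) z) := by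
    intro i y z
    have h : br Γ (basis Γ i) ∘ₗ (br Γ).flip z
        = (br Γ).flip z ∘ₗ br Γ (basis Γ i) + (br Γ).flip (br Γ (basis Γ i) z) :=
      (basis Γ).ext fun j => h1 i j z
    exact congrArg (fun f => f y) h
  have h : (br Γ).flip (br Γ y z)
      = (br Γ).flip z ∘ₗ (br Γ).flip y + br Γ y ∘ₗ (br Γ).flip z :=
    (basis Γ).ext fun i => h2 i y z
  exact congrArg (fun f => f x) h

instance : LieRing (GVir Γ) where
  bracket x y := br Γ x y
  add_lie x y z := by simp
  lie_add x y z := by simp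
  lie_self := br_self
  leibniz_lie := br_jacobi

instance : LieAlgebra ℂ (GVir Γ) where
  lie_smul t x y := (br Γ x).map_smul t y

theorem lie_L_L (α β : Γ) :
    ⁅L α, L β⁆ = (α.1 0 * β.1 1 - β.1 0 * α.1 1) • L (α + β) := br_L_L α β

theorem lie_d_L (i : Fin 2) (α : Γ) : ⁅(d i : GVir Γ), L α⁆ = (α : Fin 2 → ℂ) i • L α :=
  br_d_L i α

theorem lie_d_d (i j : Fin 2) : ⁅(d i : GVir Γ), (d j : GVir Γ)⁆ = 0 := br_d_d i j

end GVir

end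

/-! All three assertions follow from two facts: `ℒ ⊗ M` has no nonzero invariants for any `ℒ`-module
`M`, and every derivation `ℒ → ℒ ⊗ ℒ` is inner.

Invariants: contracting an invariant of `ℒ ⊗ M` with the functionals on `M` sweeps out a
finite-dimensional ideal of `ℒ` (`eq_zero_of_invariant`). Such an ideal is zero, because bracketing
with the multiples `L_{nα}` moves supports arbitrarily far (`eq_zero_of_mem_ideal`). For `M = ℒ ⊗ ℒ`
this turns the modified Yang-Baxter equation into the classical one. Together with `coJacobi_self`
it makes every coboundary bialgebra triangular.

Derivations: an inner derivation is subtracted so that `D(∂ᵢ)` has weight zero. Then `D` kills `∂ᵢ`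
and sends `L_μ` to weight `μ`. Its coordinates on `L_γ ⊗ L_{μ-γ}` form a finitely supported cocycle
(`IsDetCocycle`). Call `{γ | det α γ = 0}` the line of `α`. The crux is `pair_periodic`: `f α` is
annihilated by every `α`-periodic function that vanishes on the line of `α`. By duality `f α` is a
coboundary off that line. Once `f α` and `f β` are normalized for independent `α`, `β`, finiteness
of supports forces every `f μ` to vanish (`eq_zero_of_parallel`). The same equation links the
remaining coordinates, on `∂ᵢ ⊗ L_μ` and `L_μ ⊗ ∂ᵢ`, so that they come from a single 2×2 matrix
(`exists_matrix`). -/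

noncomputable section

namespace LieBialg

attribute [local instance] LieRing.ofAssociativeRing LieAlgebra.ofAssociativeAlgebra

/-! ### Yang-Baxter expression and co-Jacobi identity inside `L ⊗ L ⊗ L` -/

section General
variable {L : Type*} [LieRing L] [LieAlgebra ℂ L]

/-- The bracket as a bilinear map. -/
def lieBilin (L : Type*) [LieRing L] [LieAlgebra ℂ L] : L →ₗ[ℂ] L →ₗ[ℂ] L :=
  (LieAlgebra.ad ℂ L : L →ₗ[ℂ] Module.End ℂ L)

theorem lieBilin_apply (x y : L) : lieBilin L x y = ⁅x, y⁆ := rfl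

/-- The bilinear map `(x, y) ↦ c` polarizing the classical Yang-Baxter expression, with values in
`L ⊗ L ⊗ L`. -/
def ybBilin (L : Type*) [LieRing L] [LieAlgebra ℂ L] :
    L ⊗[ℂ] L →ₗ[ℂ] L ⊗[ℂ] L →ₗ[ℂ] L ⊗[ℂ] (L ⊗[ℂ] L) :=
  TensorProduct.lift <| LinearMap.mk₂ ℂ
    (fun a b => TensorProduct.map (lieBilin L a) (TensorProduct.mk ℂ L L b)
      + TensorProduct.mk ℂ L (L ⊗[ℂ] L) a ∘ₗ
        (TensorProduct.map (lieBilin L b) LinearMap.id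
          + (TensorProduct.map LinearMap.id (lieBilin L b))))
    (fun a a' b => by ext; simp [TensorProduct.add_tmul]; abel)
    (fun t a b => by ext; simp [← TensorProduct.smul_tmul'])
    (fun a b b' => by ext; simp [TensorProduct.add_tmul, TensorProduct.tmul_add]; abel)
    (fun t a b => by ext; simp [← TensorProduct.smul_tmul', TensorProduct.tmul_smul, ← smul_add])

theorem ybBilin_tmul (a b a' b' : L) :
    ybBilin L (a ⊗ₜ b) (a' ⊗ₜ b') = ⁅a, a'⁆ ⊗ₜ (b ⊗ₜ b') + a ⊗ₜ (⁅b, a'⁆ ⊗ₜ b')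
      + a ⊗ₜ (a' ⊗ₜ ⁅b, b'⁆) := by
  simp [ybBilin, lieBilin_apply, add_assoc, TensorProduct.tmul_add]

/-- The inclusion `L ⊗ L ⊗ L → 𝒰(L) ⊗ 𝒰(L) ⊗ 𝒰(L)`. -/
def incl3 (L : Type*) [LieRing L] [LieAlgebra ℂ L] : L ⊗[ℂ] (L ⊗[ℂ] L) →ₗ[ℂ] Env3 L :=
  TensorProduct.map (incl L) (TensorProduct.map (incl L) (incl L))

theorem incl3_tmul (x y z : L) :
    incl3 L (x ⊗ₜ (y ⊗ₜ z)) = incl L x ⊗ₜ (incl L y ⊗ₜ incl L z) := rfl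

theorem incl_lie (x y : L) : incl L ⁅x, y⁆ = incl L x * incl L y - incl L y * incl L x := by
  simp [incl, LieRing.of_associative_ring_bracket]

/-- In each commutator only one tensor slot carries two factors from `L`, so the result already lies
in the image of `L ⊗ L ⊗ L`. Polarizing makes the check bilinear, hence reducible to pure tensors.
-/
theorem comm3_add_eq (r s : L ⊗[ℂ] L) :
    comm3 (r12 r) (r13 s) + comm3 (r12 r) (r23 s) + comm3 (r13 r) (r23 s)
      = incl3 L (ybBilin L r s) := by
  induction r using TensorProduct.induction_on with
  | zero => simp [comm3]
  | add x y hx hy =>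
    simp only [map_add, LinearMap.add_apply, ← hx, ← hy, comm3, add_mul, mul_add]
    abel
  | tmul a b =>
    induction s using TensorProduct.induction_on with
    | zero => simp [comm3]
    | add x y hx hy =>
      simp only [map_add, ← hx, ← hy, comm3, add_mul, mul_add]
      abel
    | tmul a' b' =>
      simp only [comm3, r12_tmul, r13_tmul, r23_tmul, Algebra.TensorProduct.tmul_mul_tmul,
        one_mul, mul_one, ybBilin_tmul, map_add, incl3_tmul, incl_lie, TensorProduct.sub_tmul,
        TensorProduct.tmul_sub]

theorem c_eq (r : L ⊗[ℂ] L) : c r = incl3 L (ybBilin L r r) := comm3_add_eq r r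

theorem diagAct_incl3 (x : L) (t : L ⊗[ℂ] (L ⊗[ℂ] L)) :
    diagAct x (incl3 L t) = incl3 L ⁅x, t⁆ := by
  have h : diagAct x ∘ₗ incl3 L
      = incl3 L ∘ₗ (LieModule.toEnd ℂ L (L ⊗[ℂ] (L ⊗[ℂ] L)) x) := by
    ext a b e
    simp [incl3_tmul, diagAct_tmul, adEnv_incl, TensorProduct.tmul_add]
  exact LinearMap.congr_fun h t

/-- No Poincaré-Birkhoff-Witt theorem is needed: the adjoint representation factors through `𝒰(L)`
and is faithful when the centre is trivial. -/
theorem incl_injective (h : ∀ x : L, (∀ y : L, ⁅x, y⁆ = 0) → x = 0) :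
    Function.Injective (incl L) := by
  have had : Function.Injective (LieAlgebra.ad ℂ L) := by
    refine (injective_iff_map_eq_zero (LieAlgebra.ad ℂ L)).2 fun x hx => h x fun y => ?_
    rw [← LieAlgebra.ad_apply ℂ, hx]; rfl
  intro x y hxy
  apply had
  have := congrArg (UniversalEnvelopingAlgebra.lift ℂ (LieAlgebra.ad ℂ L)) hxy
  simpa [incl] using this

theorem incl3_injective (h : ∀ x : L, (∀ y : L, ⁅x, y⁆ = 0) → x = 0) :
    Function.Injective (incl3 L) :=
  TensorProduct.map_injective_of_flat_flat _ _ (incl_injective h)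
    (TensorProduct.map_injective_of_flat_flat _ _ (incl_injective h) (incl_injective h))

theorem cybe_iff_mybe (hz : ∀ x : L, (∀ y : L, ⁅x, y⁆ = 0) → x = 0)
    (hinv : ∀ t : L ⊗[ℂ] (L ⊗[ℂ] L), (∀ x : L, ⁅x, t⁆ = 0) → t = 0) (r : L ⊗[ℂ] L) :
    CYBE r ↔ MYBE r := by
  constructor
  · intro h x
    rw [show c r = 0 from h, map_zero]
  · intro h
    have : ybBilin L r r = 0 := hinv _ fun x => incl3_injective hz <| by
      rw [← diagAct_incl3, ← c_eq, h x, map_zero]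
    rw [CYBE, c_eq, this, map_zero]

/-- The sum over cyclic permutations of `(1 ⊗ Δ_r) Δ_s`. -/
def coJacobi (x : L) (r s : L ⊗[ℂ] L) : L ⊗[ℂ] (L ⊗[ℂ] L) :=
  (LinearMap.id + cyclic L + cyclic L ∘ₗ cyclic L : L ⊗[ℂ] (L ⊗[ℂ] L) →ₗ[ℂ] _)
    (LinearMap.lTensor L (coboundary r) ⁅x, s⁆)

theorem coboundary_tmul (a b y : L) : coboundary (a ⊗ₜ[ℂ] b) y = ⁅y, a⁆ ⊗ₜ b + a ⊗ₜ ⁅y, b⁆ := by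
  simp [coboundary_apply]

-- The polarized form of `coJacobi_self` on generators `a ∧ b`, `a' ∧ b'`. Both sides expand into
-- the same elementary tensors by the Jacobi identity.
set_option maxRecDepth 10000 in
theorem coJacobi_tmul (x a b a' b' : L) :
    coJacobi x (a ⊗ₜ b - b ⊗ₜ a) (a' ⊗ₜ b' - b' ⊗ₜ a')
      + coJacobi x (a' ⊗ₜ b' - b' ⊗ₜ a') (a ⊗ₜ b - b ⊗ₜ a)
      = ⁅x, ybBilin L (a ⊗ₜ b - b ⊗ₜ a) (a' ⊗ₜ b' - b' ⊗ₜ a')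
        + ybBilin L (a' ⊗ₜ b' - b' ⊗ₜ a') (a ⊗ₜ b - b ⊗ₜ a)⁆ := by
  -- Fixing one orientation for every bracket lets `abel` recognize equal terms.
  have n1 : ⁅a', a⁆ = -⁅a, a'⁆ := (lie_skew a' a).symm
  have n2 : ⁅a', b⁆ = -⁅b, a'⁆ := (lie_skew a' b).symm
  have n3 : ⁅b', a⁆ = -⁅a, b'⁆ := (lie_skew b' a).symm
  have n4 : ⁅b', b⁆ = -⁅b, b'⁆ := (lie_skew b' b).symm
  have m1 : ∀ u v : L, ⁅u, ⁅x, v⁆⁆ = -⁅⁅x, v⁆, u⁆ := fun u v => (lie_skew u ⁅x, v⁆).symm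
  have cob : ∀ r s : L ⊗[ℂ] L, coboundary (r - s) = coboundary r - coboundary s := by
    intro r s; ext y; simp [coboundary_apply]
  simp only [coJacobi, cob, map_sub, LinearMap.sub_apply, lie_sub, lie_add,
    TensorProduct.LieModule.lie_tmul_right, map_add, LinearMap.lTensor_tmul, coboundary_tmul,
    LinearMap.add_apply, LinearMap.id_apply, LinearMap.comp_apply, cyclic_tmul, ybBilin_tmul,
    TensorProduct.tmul_add, LinearMap.lTensor_sub, n1, n2, n3, n4,
    leibniz_lie x, m1, TensorProduct.add_tmul, TensorProduct.neg_tmul, TensorProduct.tmul_neg,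
    map_neg, lie_neg]
  abel

theorem coboundary_add (r s : L ⊗[ℂ] L) : coboundary (r + s) = coboundary r + coboundary s := by
  ext y; simp [coboundary_apply]

theorem coJacobi_add_left (x : L) (r s t : L ⊗[ℂ] L) :
    coJacobi x (r + s) t = coJacobi x r t + coJacobi x s t := by
  simp only [coJacobi, coboundary_add, LinearMap.lTensor_add, LinearMap.add_apply, map_add]

theorem coJacobi_add_right (x : L) (r s t : L ⊗[ℂ] L) :
    coJacobi x t (r + s) = coJacobi x t r + coJacobi x t s := by
  simp only [coJacobi, lie_add, map_add]

theorem coJacobi_symm (x : L) {r s : L ⊗[ℂ] L} (hr : r ∈ skewTensors L)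
    (hs : s ∈ skewTensors L) :
    coJacobi x r s + coJacobi x s r = ⁅x, ybBilin L r s + ybBilin L s r⁆ := by
  obtain ⟨t, rfl⟩ := hr
  obtain ⟨t', rfl⟩ := hs
  have h0 : ∀ t, coJacobi x (0 : L ⊗[ℂ] L) t = 0 := fun t => by
    simpa using coJacobi_add_left x 0 0 t
  have h0' : ∀ t, coJacobi x t (0 : L ⊗[ℂ] L) = 0 := fun t => by
    simpa using coJacobi_add_right x 0 0 t
  induction t using TensorProduct.induction_on with
  | zero => simp only [map_zero, h0, h0', LinearMap.zero_apply, lie_zero, add_zero]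
  | add u v hu hv =>
    simp only [map_add, coJacobi_add_left, coJacobi_add_right, LinearMap.add_apply,
      lie_add] at hu hv ⊢
    rw [add_add_add_comm, hu, hv]
    abel
  | tmul a b =>
    induction t' using TensorProduct.induction_on with
    | zero => simp only [map_zero, h0, h0', LinearMap.zero_apply, lie_zero, add_zero]
    | add u v hu hv =>
      simp only [map_add, coJacobi_add_left, coJacobi_add_right, LinearMap.add_apply,
        lie_add] at hu hv ⊢
      rw [add_add_add_comm, hu, hv]
      abel
    | tmul a' b' => exact coJacobi_tmul x a b a' b'

/-- For skew `r`, the dual Jacobi identity for `Δ_r` amounts to the modified Yang-Baxter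
equation. -/
theorem coJacobi_self (x : L) {r : L ⊗[ℂ] L} (hr : r ∈ skewTensors L) :
    coJacobi x r r = ⁅x, ybBilin L r r⁆ := by
  have h := coJacobi_symm x hr hr
  rw [lie_add, ← two_smul ℂ, ← two_smul ℂ] at h
  exact smul_right_injective _ (two_ne_zero (α := ℂ)) h

theorem mem_skewTensors_of_twist {r : L ⊗[ℂ] L} (h : twist L r = -r) : r ∈ skewTensors L := by
  refine ⟨(2⁻¹ : ℂ) • r, ?_⟩
  rw [LinearMap.sub_apply, LinearMap.id_apply, map_smul, h, smul_neg, sub_neg_eq_add, ← add_smul]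
  norm_num

theorem twist_of_mem_skewTensors {r : L ⊗[ℂ] L} (h : r ∈ skewTensors L) : twist L r = -r := by
  obtain ⟨t, rfl⟩ := h
  have : twist L (twist L t) = t := (TensorProduct.comm ℂ L L).symm_apply_apply t
  simp [this]

theorem twist_lie (x : L) (r : L ⊗[ℂ] L) : twist L ⁅x, r⁆ = ⁅x, twist L r⁆ := by
  induction r using TensorProduct.induction_on with
  | zero => simp
  | add u v hu hv => simp only [lie_add, map_add, hu, hv]
  | tmul a b => simp [twist_tmul, add_comm]

/-- If `L ⊗ L` and `L ⊗ L ⊗ L` have no invariants, coboundary Lie bialgebras are triangular. -/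
theorem IsLieBialgebra.isTriangular
    (h2 : ∀ t : L ⊗[ℂ] L, (∀ x : L, ⁅x, t⁆ = 0) → t = 0)
    (h3 : ∀ t : L ⊗[ℂ] (L ⊗[ℂ] L), (∀ x : L, ⁅x, t⁆ = 0) → t = 0) {Δ : L →ₗ[ℂ] L ⊗[ℂ] L}
    (hΔ : IsLieBialgebra Δ) {r : L ⊗[ℂ] L} (hr : Δ = coboundary r) : IsTriangular Δ r := by
  have hskew : r ∈ skewTensors L := by
    -- As `Δ` takes skew values, `τ(r) + r` is invariant, hence zero.
    refine mem_skewTensors_of_twist (eq_neg_of_add_eq_zero_left (h2 _ fun x => ?_))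
    have h := twist_of_mem_skewTensors (hΔ.anticomm ⟨x, rfl⟩)
    rw [hr, coboundary_apply, twist_lie] at h
    rw [lie_add, h, neg_add_cancel]
  have hyb : ybBilin L r r = 0 := h3 _ fun x => by
    rw [← coJacobi_self x hskew]
    have h := LinearMap.congr_fun hΔ.jacobi x
    rw [hr] at h
    exact h
  exact { toIsLieBialgebra := hΔ, skew := hskew, eq_coboundary := hr,
          cybe := by rw [CYBE, c_eq, hyb, map_zero] }

end General
end LieBialg

namespace GVir

variable {Γ : AddSubgroup (Fin 2 → ℂ)}

/-! ### The symplectic form -/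

theorem det_add_left (α β γ : Γ) : det (α + β) γ = det α γ + det β γ := by
  simp only [det, AddSubgroup.coe_add, Pi.add_apply]; ring

theorem det_add_right (α β γ : Γ) : det α (β + γ) = det α β + det α γ := by
  simp only [det, AddSubgroup.coe_add, Pi.add_apply]; ring

theorem det_sub_right (α β γ : Γ) : det α (β - γ) = det α β - det α γ := by
  simp only [det, AddSubgroup.coe_sub, Pi.sub_apply]; ring

theorem det_nsmul_right (n : ℕ) (α β : Γ) : det α (n • β) = n * det α β := by
  simp [det]; ring

theorem det_nsmul_left (n : ℕ) (α β : Γ) : det (n • α) β = n * det α β := by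
  simp [det]; ring

theorem det_zsmul_right (n : ℤ) (α β : Γ) : det α (n • β) = n * det α β := by
  simp [det]; ring

theorem det_self (α : Γ) : det α α = 0 := by
  simp only [det]; ring

theorem det_zero_right (α : Γ) : det α 0 = 0 := by simp [det]

theorem det_zero_left (α : Γ) : det 0 α = 0 := by simp [det]

theorem det_swap (α β : Γ) : det β α = -det α β := by
  simp only [det]; ring

/-- The Plücker relation. -/
theorem det_mul_det (α β γ δ : Γ) :
    det α β * det γ δ = det α γ * det β δ - det β γ * det α δ := by
  simp only [det]; ring

theorem eq_zero_of_det_eq_zero {α β γ : Γ} (h : det α β ≠ 0) (hα : det α γ = 0)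
    (hβ : det β γ = 0) : γ = 0 := by
  simp only [det] at *
  have h0 : (α.1 0 * β.1 1 - β.1 0 * α.1 1) * γ.1 0 = 0 := by
    linear_combination β.1 0 * hα - α.1 0 * hβ
  have h1 : (α.1 0 * β.1 1 - β.1 0 * α.1 1) * γ.1 1 = 0 := by
    linear_combination β.1 1 * hα - α.1 1 * hβ
  ext i
  fin_cases i
  · simpa [h] using h0
  · simpa [h] using h1

theorem nsmul_left_injective {α : Γ} (hα : α ≠ 0) : Function.Injective fun n : ℕ => n • α := by
  intro m n h
  have h1 : m • (α : Fin 2 → ℂ) = n • (α : Fin 2 → ℂ) := by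
    simpa using congrArg Subtype.val h
  have h2 : (α : Fin 2 → ℂ) ≠ 0 := fun h => hα (Subtype.ext h)
  obtain ⟨i, hi⟩ := Function.ne_iff.1 h2
  have h3 := congrFun h1 i
  simp at h3
  exact h3.resolve_right hi

/-- A function of finite support which is invariant under `γ ↦ γ - α` on a set stable under this
map vanishes there. -/
theorem eq_zero_of_shift_invariant {φ : Γ → ℂ} (hφ : φ.support.Finite) {α : Γ} (hα : α ≠ 0)
    {S : Set Γ} (hS : ∀ γ ∈ S, γ - α ∈ S) (h : ∀ γ ∈ S, φ (γ - α) = φ γ) :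
    ∀ γ ∈ S, φ γ = 0 := by
  intro γ hγ
  by_contra hne
  have key : ∀ n : ℕ, γ - n • α ∈ S ∧ φ (γ - n • α) = φ γ := by
    intro n
    induction n with
    | zero => simpa using hγ
    | succ n ih =>
      have e : γ - (n + 1) • α = γ - n • α - α := by rw [succ_nsmul]; abel
      rw [e]
      exact ⟨hS _ ih.1, (h _ ih.1).trans ih.2⟩
  refine Set.infinite_of_injective_forall_mem (f := fun n : ℕ => γ - n • α) ?_ ?_ hφ
  · intro m n hmn
    exact nsmul_left_injective hα (sub_right_injective hmn)
  · intro n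
    simpa [(key n).2] using hne

/-- The source of all general-position choices of integer multiples below. -/
theorem eventually_mul_notMem {b : ℂ} (hb : b ≠ 0) {S : Set ℂ} (hS : S.Finite) :
    ∀ᶠ n : ℕ in Filter.atTop, (n : ℂ) * b ∉ S := by
  have hinj : Function.Injective fun n : ℕ => (n : ℂ) * b := by
    intro m n h
    exact_mod_cast mul_right_cancel₀ hb h
  have := hinj.tendsto_cofinite hS.compl_mem_cofinite
  rwa [Nat.cofinite_eq_atTop] at this

/-! ### Pairing functions with functions of finite support -/

/-- The sum `∑ ψ(γ) φ(γ)`. -/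
def pair (ψ φ : Γ → ℂ) : ℂ := ∑ᶠ γ, ψ γ * φ γ

theorem finite_support_mul {φ : Γ → ℂ} (hφ : φ.support.Finite) (ψ : Γ → ℂ) :
    (fun γ => ψ γ * φ γ).support.Finite :=
  hφ.subset fun _ hγ => right_ne_zero_of_mul hγ

theorem pair_congr {ψ ψ' φ : Γ → ℂ} (h : ∀ γ, φ γ ≠ 0 → ψ γ = ψ' γ) : pair ψ φ = pair ψ' φ := by
  refine finsum_congr fun γ => ?_
  by_cases hγ : φ γ = 0
  · simp [hγ]
  · rw [h γ hγ]

theorem pair_add {φ : Γ → ℂ} (hφ : φ.support.Finite) (ψ ψ' : Γ → ℂ) :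
    pair (fun γ => ψ γ + ψ' γ) φ = pair ψ φ + pair ψ' φ := by
  unfold pair
  rw [← finsum_add_distrib (finite_support_mul hφ ψ) (finite_support_mul hφ ψ')]
  exact finsum_congr fun γ => add_mul _ _ _

theorem pair_smul (a : ℂ) (ψ φ : Γ → ℂ) : pair (fun γ => a * ψ γ) φ = a * pair ψ φ := by
  unfold pair
  rw [mul_finsum]
  exact finsum_congr fun γ => mul_assoc _ _ _

theorem pair_affine {φ : Γ → ℂ} (hφ : φ.support.Finite) (a b c : ℂ) (u v ψ : Γ → ℂ) :
    pair (fun γ => (a + b * u γ + c * v γ) * ψ γ) φ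
      = a * pair ψ φ + b * pair (fun γ => u γ * ψ γ) φ + c * pair (fun γ => v γ * ψ γ) φ := by
  rw [← pair_smul a, ← pair_smul b, ← pair_smul c, ← pair_add hφ, ← pair_add hφ]
  exact pair_congr fun γ _ => by ring

theorem finsum_shift (F : Γ → ℂ) (α : Γ) : ∑ᶠ γ, F γ = ∑ᶠ γ, F (γ + α) :=
  (finsum_comp_equiv (Equiv.addRight α)).symm

/-! ### Cocycles in coordinates -/

open Classical in
/-- The equation satisfied by the coordinates `f μ γ` of `D(L_μ)` on `L_γ ⊗ L_{μ-γ}`, for a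
derivation `D` of weight zero. The function `B` records the coordinates on `∂ᵢ ⊗ L_μ` and
`L_μ ⊗ ∂ᵢ`. -/
structure IsDetCocycle (f B : Γ → Γ → ℂ) : Prop where
  finite : ∀ μ, (f μ).support.Finite
  zero_left : ∀ γ, f 0 γ = 0
  zero_right : ∀ μ, f μ 0 = 0
  self : ∀ μ, f μ μ = 0
  eq : ∀ α β γ, det α β * f (α + β) γ
    = det α γ * f β (γ - α) + det α (α + β - γ) * f β γ
      - det β γ * f α (γ - β) - det β (α + β - γ) * f α γ
      - (if γ = α then B α β else 0) + (if γ = β then B β α else 0)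

namespace IsDetCocycle

variable {f B : Γ → Γ → ℂ}

theorem eq_of_ne (h : IsDetCocycle f B) {α β γ : Γ} (h1 : γ ≠ α) (h2 : γ ≠ β) :
    det α β * f (α + β) γ = det α γ * f β (γ - α) + det α (β - γ) * f β γ
      - det β γ * f α (γ - β) - det β (α - γ) * f α γ := by
  rw [h.eq, if_neg h1, if_neg h2]
  simp only [det_sub_right, det_add_right, det_self]
  ring

/-- The weak form of the cocycle equation: shifts of `f` are moved onto the test function by
translating the summation variable. Vanishing of `ψ` at `α` and `β` removes the `B` terms. -/
theorem pair_eq (h : IsDetCocycle f B) (α β : Γ) {ψ : Γ → ℂ} (hα : ψ α = 0) (hβ : ψ β = 0) :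
    det α β * pair ψ (f (α + β))
      = pair (fun γ => det α (β - γ) * ψ γ + det α γ * ψ (γ + α)) (f β)
        - pair (fun γ => det β (α - γ) * ψ γ + det β γ * ψ (γ + β)) (f α) := by
  have key : ∀ γ, det α β * (ψ γ * f (α + β) γ)
      = (ψ γ * (det α γ * f β (γ - α)) + (det α (β - γ) * ψ γ) * f β γ)
        - (ψ γ * (det β γ * f α (γ - β)) + (det β (α - γ) * ψ γ) * f α γ) := by
    intro γ
    by_cases h1 : γ = α
    · subst h1; simp [hα]
    by_cases h2 : γ = β
    · subst h2; simp [hβ]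
    linear_combination ψ γ * h.eq_of_ne h1 h2
  have fin : ∀ (α β : Γ), (fun γ => ψ γ * (det α γ * f β (γ - α))).support.Finite := by
    intro α β
    refine (((h.finite β).image fun γ => γ + α)).subset fun γ hγ => ⟨γ - α, ?_, by simp⟩
    exact right_ne_zero_of_mul (right_ne_zero_of_mul hγ)
  have shift : ∀ (α β : Γ), ∑ᶠ γ, ψ γ * (det α γ * f β (γ - α))
      = pair (fun γ => det α γ * ψ (γ + α)) (f β) := by
    intro α β
    rw [finsum_shift _ α]
    refine finsum_congr fun γ => ?_
    rw [add_sub_cancel_right, det_add_right, det_self]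
    ring
  rw [pair_add (h.finite β), pair_add (h.finite α), ← shift, ← shift]
  unfold pair
  rw [mul_finsum, finsum_congr key, finsum_sub_distrib, finsum_add_distrib, finsum_add_distrib]
  · ring
  · exact fin _ _
  · exact finite_support_mul (h.finite α) _
  · exact fin _ _
  · exact finite_support_mul (h.finite β) _
  · exact ((fin α β).union (finite_support_mul (h.finite β) _)).subset
      (Function.support_add _ _)
  · exact ((fin β α).union (finite_support_mul (h.finite α) _)).subset
      (Function.support_add _ _)

/-- Reaching `2α + β` from `β` in two steps by `α` or in one step by `2α` gives relations that
eliminate `f` at `β`, `α + β` and `2α + β`. The leftover `f (2α)` is eliminated by the equation for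
the pair `α, 2α`, whose left side vanishes. The point is that the right side of the conclusion does
not involve `β`. -/
theorem det_mul_pair (h : IsDetCocycle f B) {α β : Γ} (hb : det α β ≠ 0) {χ : Γ → ℂ}
    (hper : ∀ γ, χ (γ + α) = χ γ) (h0 : ∀ γ, det α γ = 0 → χ γ = 0) (hβ : χ β = 0)
    (far : ∀ γ, f α γ ≠ 0 → χ (γ + β) = 0) (far2 : ∀ γ, f (α + α) γ ≠ 0 → χ (γ + β) = 0) :
    det α β * pair χ (f α) = pair (fun γ => det α γ * χ γ) (f α) := by
  have hα : χ α = 0 := h0 _ (det_self α)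
  have hαα : χ (α + α) = 0 := by rw [hper, hα]
  have hαβ : χ (α + β) = 0 := by rw [add_comm, hper, hβ]
  have hper2 : ∀ γ, χ (γ + (α + α)) = χ γ := fun γ => by rw [← add_assoc, hper, hper]
  have hba : det β α = -det α β := det_swap α β
  have hfin := h.finite α
  -- the three equations relating `β`, `α + β`, `2α + β`
  have e1 := h.pair_eq α β hα hβ
  have e2 := h.pair_eq α (α + β) hα hαβ
  have e3 := h.pair_eq (α + α) β hαα hβ
  rw [pair_congr (ψ' := fun γ => det α β * χ γ) (φ := f β) (fun γ _ => by
      simp only [hper, det_sub_right]; ring),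
    pair_congr (ψ' := fun γ => (-det α β + (-1) * det β γ + 0 * det α γ) * χ γ) (φ := f α)
      (fun γ hγ => by simp only [far γ hγ, det_sub_right, hba]; ring),
    pair_smul, pair_affine hfin] at e1
  rw [pair_congr (ψ' := fun γ => det α β * χ γ) (φ := f (α + β)) (fun γ _ => by
      simp only [hper, det_sub_right, det_add_right, det_self]; ring),
    pair_congr (ψ' := fun γ => (-det α β + (-1) * det β γ + (-1) * det α γ) * χ γ) (φ := f α)
      (fun γ hγ => by
        rw [add_comm α β, ← add_assoc, hper, far γ hγ]
        simp only [det_sub_right, det_add_left, det_self, hba]; ring),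
    pair_smul, pair_affine hfin, det_add_right, det_self, zero_add] at e2
  rw [pair_congr (ψ' := fun γ => (2 * det α β) * χ γ) (φ := f β) (fun γ _ => by
      simp only [hper2, det_sub_right, det_add_left]; ring),
    pair_congr (ψ' := fun γ => det β (α + α - γ) * χ γ) (φ := f (α + α))
      (fun γ hγ => by simp only [far2 γ hγ]; ring),
    pair_smul, det_add_left, add_assoc] at e3
  -- the equation relating `α` and `2α`
  set θ : Γ → ℂ := fun γ => det β γ ^ 2 / (2 * det α β) + 5 / 2 * det β γ with hθ
  -- The quadratic `θ` solves `θ(γ + α) - θ(γ) = det β (2α - γ)`, which fixes the constant `5/2`.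
  -- The transposed operator on the `f (2α)` side then yields exactly the weight occurring in `e3`.
  -- Dividing by `det α γ` is harmless because `χ` vanishes where it is zero.
  have e4 := h.pair_eq α (α + α) (ψ := fun γ => χ γ * (det α γ)⁻¹ * θ γ) (by simp [hα])
    (by simp [hαα])
  rw [det_add_right, det_self, add_zero, zero_mul,
    pair_congr (ψ' := fun γ => det β (α + α - γ) * χ γ) (φ := f (α + α)) (fun γ _ => by
      by_cases hγ : det α γ = 0
      · simp [h0 γ hγ, hγ]
      · simp only [hper, det_sub_right, det_add_right, det_self, hθ, hba, add_zero]
        field_simp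
        ring),
    pair_congr (ψ' := fun γ => (-6 * det α β + (-4) * det β γ + 0 * det α γ) * χ γ) (φ := f α)
      (fun γ _ => by
      by_cases hγ : det α γ = 0
      · simp [h0 γ hγ, hγ, det_add_left]
      · simp only [hper2, det_sub_right, det_add_right, det_add_left, det_self, hθ, hba,
          add_zero]
        field_simp
        ring), pair_affine hfin] at e4
  linear_combination e1 + e2 - (1 / 2) * e3 - (1 / 2) * e4

/-- In `det_mul_pair` the left side scales with `β` while the right side stays fixed. Comparing two
large multiples of `β` therefore forces the pairing to vanish. -/
theorem pair_periodic (h : IsDetCocycle f B) {α β : Γ} (hb : det α β ≠ 0) {χ : Γ → ℂ}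
    (hper : ∀ γ, χ (γ + α) = χ γ) (h0 : ∀ γ, det α γ = 0 → χ γ = 0) :
    pair χ (f α) = 0 := by
  classical
  -- Cutting `χ` off to the finitely many relevant values of `det α` keeps it `α`-periodic.
  -- Translation by a large multiple of `β` then leaves `G`, which gives both `far` conditions.
  set G : Set ℂ := det α '' ((f α).support ∪ (f (α + α)).support) with hG
  have hGfin : G.Finite := ((h.finite α).union (h.finite (α + α))).image _
  set χ' : Γ → ℂ := fun γ => if det α γ ∈ G then χ γ else 0 with hχ'
  have hχχ' : pair χ (f α) = pair χ' (f α) := pair_congr fun γ hγ => by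
    rw [hχ']
    exact (if_pos ⟨γ, Or.inl hγ, rfl⟩).symm
  have good : ∀ᶠ n : ℕ in Filter.atTop, ((n : ℂ) * det α β) * pair χ' (f α)
      = pair (fun γ => det α γ * χ' γ) (f α) := by
    filter_upwards [eventually_mul_notMem hb hGfin,
      eventually_mul_notMem hb ((hGfin.prod hGfin).image fun p => p.1 - p.2),
      Filter.eventually_ne_atTop 0] with n h1 h2 h3
    have far : ∀ γ, det α γ ∈ G → χ' (γ + n • β) = 0 := by
      intro γ hγ
      refine if_neg fun hmem => h2 ⟨(det α (γ + n • β), det α γ), ⟨hmem, hγ⟩, ?_⟩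
      simp [det_add_right, det_nsmul_right]
    rw [← det_nsmul_right]
    refine h.det_mul_pair ?_ ?_ ?_ ?_ ?_ ?_
    · rw [det_nsmul_right]
      exact mul_ne_zero (Nat.cast_ne_zero.2 h3) hb
    · intro γ
      simp only [hχ', det_add_right, det_self, add_zero, hper]
    · intro γ hγ
      simp [hχ', h0 γ hγ]
    · simp only [hχ', det_nsmul_right]
      exact if_neg h1
    · exact fun γ hγ => far γ ⟨γ, Or.inl hγ, rfl⟩
    · exact fun γ hγ => far γ ⟨γ, Or.inr hγ, rfl⟩
  obtain ⟨N, hN⟩ := Filter.eventually_atTop.1 good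
  have h1 := hN N le_rfl
  have h2 := hN (N + 1) (Nat.le_succ N)
  push_cast at h2
  have h3 : det α β * pair χ' (f α) = 0 := by linear_combination h2 - h1
  rw [hχχ']
  exact (mul_eq_zero.1 h3).resolve_left hb

/-- Coboundaries satisfy the cocycle equation and may be subtracted. -/
theorem sub_coboundary (h : IsDetCocycle f B) (c : Γ →₀ ℂ) :
    IsDetCocycle (fun α γ => f α γ - det α γ * (c (γ - α) - c γ)) B where
  finite μ := by
    refine ((h.finite μ).union ((c.hasFiniteSupport.image (· + μ)).union
      c.hasFiniteSupport)).subset ?_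
    intro γ hγ
    by_contra hn
    simp only [Set.mem_union, Set.mem_image, Function.mem_support, not_or, not_exists, not_and,
      not_not] at hn
    have h1 : c (γ - μ) = 0 := by
      by_contra h2
      exact hn.2.1 _ h2 (sub_add_cancel _ _)
    exact hγ (by simp [h1, hn.1, hn.2.2])
  zero_left γ := by simp [h.zero_left, det_zero_left]
  zero_right μ := by simp [h.zero_right, det_zero_right]
  self μ := by simp [h.self, det_self]
  eq α β γ := by
    have e := h.eq α β γ
    have e1 : γ - β - α = γ - (α + β) := by abel
    have e2 : γ - α - β = γ - (α + β) := by abel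
    have hba : det β α = -det α β := det_swap α β
    simp only [e1, e2, det_sub_right, det_add_right, det_add_left, det_self, hba] at e ⊢
    linear_combination e

/-- Off the line through `α`, `f α` is a coboundary. -/
theorem exists_coboundary (h : IsDetCocycle f B) {α β : Γ} (hb : det α β ≠ 0) :
    ∃ c : Γ →₀ ℂ, ∀ γ, det α γ ≠ 0 → f α γ = det α γ * (c (γ - α) - c γ) := by
  classical
  let T : (Γ →₀ ℂ) →ₗ[ℂ] (Γ →₀ ℂ) := Finsupp.linearCombination ℂ fun γ =>
    det α γ • (Finsupp.single (γ + α) (1 : ℂ) - Finsupp.single γ 1)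
  have hT : ∀ c γ, T c γ = det α γ * (c (γ - α) - c γ) := by
    intro c γ
    induction c using Finsupp.induction_linear with
    | zero => simp
    | add x y hx hy => rw [map_add, Finsupp.add_apply, hx, hy]; simp; ring
    | single δ a =>
      simp only [T, Finsupp.linearCombination_single, Finsupp.smul_apply, Finsupp.sub_apply,
        Finsupp.single_apply, smul_eq_mul, eq_sub_iff_add_eq]
      by_cases h1 : δ + α = γ
      · subst h1
        have : δ + α ≠ δ := by
          intro h2
          have : α = 0 := by simpa using h2
          simp [this, det_zero_left] at hb
        simp [this.symm, det_add_right, det_self]; ring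
      · by_cases h2 : δ = γ
        · subst h2; simp [h1]; ring
        · simp [h1, h2]
  -- A functional kills `N` exactly when its values on point masses are `α`-periodic and vanish on
  -- the line of `α`. Separating `F` from `N` would therefore contradict `pair_periodic`.
  let N : Submodule ℂ (Γ →₀ ℂ) := LinearMap.range T ⊔ Finsupp.supported ℂ ℂ {γ | det α γ = 0}
  let F : Γ →₀ ℂ := Finsupp.ofSupportFinite (f α) (h.finite α)
  have hF : F ∈ N := by
    by_contra hn
    obtain ⟨l, hl, hN⟩ := Submodule.exists_le_ker_of_notMem hn
    refine hl ?_
    have key := h.pair_periodic hb (χ := fun γ => l (Finsupp.single γ 1)) ?_ ?_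
    · have e : F = ∑ γ ∈ F.support, F γ • Finsupp.single γ (1 : ℂ) := by
        conv_lhs => rw [← F.sum_single]
        simp [Finsupp.sum]
      rw [e, map_sum, ← key]
      unfold pair
      rw [finsum_eq_sum_of_support_subset (s := F.support)]
      · exact Finset.sum_congr rfl fun γ _ => by rw [map_smul, smul_eq_mul, mul_comm]; rfl
      · intro γ hγ
        exact Finsupp.mem_support_iff.2 (right_ne_zero_of_mul hγ)
    · intro γ
      by_cases hγ : det α γ = 0
      · have h1 : ∀ δ, det α δ = 0 → l (Finsupp.single δ 1) = 0 := fun δ hδ =>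
          hN (Submodule.mem_sup_right (Finsupp.single_mem_supported ℂ 1 hδ))
        rw [h1 _ hγ, h1 _ (by simp [det_add_right, det_self, hγ])]
      · have h1 : l (T (Finsupp.single γ 1)) = 0 := hN (Submodule.mem_sup_left ⟨_, rfl⟩)
        simp only [T, Finsupp.linearCombination_single, one_smul, map_smul, map_sub,
          smul_eq_mul, mul_eq_zero, hγ, false_or] at h1
        exact sub_eq_zero.1 h1
    · intro δ hδ
      exact hN (Submodule.mem_sup_right (Finsupp.single_mem_supported ℂ 1 hδ))
  obtain ⟨_, ⟨c, rfl⟩, y, hy, hxy⟩ := Submodule.mem_sup.1 hF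
  refine ⟨c, fun γ hγ => ?_⟩
  have h1 : y γ = 0 := (Finsupp.mem_supported' ℂ y).1 hy γ hγ
  have h2 := DFunLike.congr_fun hxy γ
  rw [Finsupp.add_apply, h1, hT, add_zero] at h2
  exact h2.symm

/-- In the equation for `α, 2α` the left side is zero and the `f α` terms vanish off the line. What
remains says that `f (2α)` is invariant under translation by `α` there, so finite support kills it.
-/
theorem add_self_eq_zero (h : IsDetCocycle f B) {α : Γ} (hα : α ≠ 0)
    (hf : ∀ γ, det α γ ≠ 0 → f α γ = 0) : ∀ γ, det α γ ≠ 0 → f (α + α) γ = 0 := by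
  refine eq_zero_of_shift_invariant (S := {γ | det α γ ≠ 0}) (h.finite _) hα ?_ ?_
  · intro γ hγ
    simpa [det_sub_right, det_self] using hγ
  · intro γ hγ
    have hγ' : det α γ ≠ 0 := hγ
    have h1 : γ ≠ α := by rintro rfl; exact hγ' (det_self _)
    have h2 : γ ≠ α + α := by rintro rfl; exact hγ' (by simp [det_add_right, det_self])
    have e := h.eq_of_ne h1 h2
    rw [hf γ hγ', hf (γ - (α + α)) (by simpa [det_sub_right, det_add_right, det_self] using hγ')]
      at e
    simp only [det_sub_right, det_add_right, det_self] at e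
    have e' : det α γ * (f (α + α) (γ - α) - f (α + α) γ) = 0 := by linear_combination -e
    exact sub_eq_zero.1 ((mul_eq_zero.1 e').resolve_left hγ')

/-- If `f α` is supported on the line through `α`, every `f β` is supported on the two
translates of this line through `0` and `β`. -/
theorem eq_zero_of_det_ne (h : IsDetCocycle f B) {α β : Γ} (hb : det α β ≠ 0)
    (hf : ∀ γ, det α γ ≠ 0 → f α γ = 0) :
    ∀ γ, det α γ ≠ 0 → det α γ ≠ det α β → f β γ = 0 := by
  have hα : α ≠ 0 := by rintro rfl; exact hb (det_zero_left _)
  have hf2 := h.add_self_eq_zero hα hf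
  set S : Set Γ := {γ | det α γ ≠ 0 ∧ det α γ ≠ det α β} with hS
  have stab : ∀ γ ∈ S, γ - α ∈ S := by
    intro γ hγ
    simpa [hS, det_sub_right, det_self] using hγ
  have step : ∀ γ ∈ S, det α β * f (α + β) γ
      = det α γ * f β (γ - α) + (det α β - det α γ) * f β γ := by
    intro γ ⟨h0, hne⟩
    have h1 : γ ≠ α := by rintro rfl; exact h0 (det_self _)
    have h2 : γ ≠ β := by rintro rfl; exact hne rfl
    rw [h.eq_of_ne h1 h2, hf γ h0, hf (γ - β) (by
      rw [det_sub_right]; exact sub_ne_zero.2 hne), det_sub_right]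
    ring
  have step' : ∀ γ ∈ S, det α β * f (α + (α + β)) γ
      = det α γ * f (α + β) (γ - α) + (det α β - det α γ) * f (α + β) γ := by
    intro γ ⟨h0, hne⟩
    have h1 : γ ≠ α := by rintro rfl; exact h0 (det_self _)
    have h2 : γ ≠ α + β := by rintro rfl; exact hne (by simp [det_add_right, det_self])
    have e := h.eq_of_ne h1 h2
    rw [hf γ h0, hf (γ - (α + β)) (by
      rw [det_sub_right, det_add_right, det_self, zero_add]; exact sub_ne_zero.2 hne)] at e
    simp only [det_sub_right, det_add_right, det_self] at e
    linear_combination e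
  have step2 : ∀ γ ∈ S, 2 * det α β * f (α + (α + β)) γ
      = 2 * det α γ * f β (γ - α - α) + 2 * (det α β - det α γ) * f β γ := by
    intro γ ⟨h0, hne⟩
    have h1 : γ ≠ α + α := by rintro rfl; exact h0 (by simp [det_add_right, det_self])
    have h2 : γ ≠ β := by rintro rfl; exact hne rfl
    have e := h.eq_of_ne h1 h2
    rw [hf2 γ h0, hf2 (γ - β) (by
      rw [det_sub_right]; exact sub_ne_zero.2 hne)] at e
    simp only [det_sub_right, det_add_left, ← sub_sub, add_assoc] at e
    linear_combination e
  -- Eliminating `f (α + β)` and `f (2α + β)` leaves a vanishing second difference of `f β` along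
  -- `α`. Finite support then kills the first difference, and afterwards `f β` itself.
  have second : ∀ γ ∈ S, f β (γ - α) - f β (γ - α - α) = f β γ - f β (γ - α) := by
    intro γ hγ
    have e1 := step γ hγ
    have e1' := step (γ - α) (stab γ hγ)
    have e2 := step' γ hγ
    have e3 := step2 γ hγ
    simp only [det_sub_right, det_self, sub_zero] at e1'
    have h1 : det α γ * (det α β - det α γ)
        * ((f β (γ - α) - f β (γ - α - α)) - (f β γ - f β (γ - α))) = 0 := by
      linear_combination (det α β / 2) * e3 - det α β * e2 - (det α β - det α γ) * e1
        - det α γ * e1'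
    have h2 : det α γ * (det α β - det α γ) ≠ 0 :=
      mul_ne_zero hγ.1 (sub_ne_zero.2 (Ne.symm hγ.2))
    exact sub_eq_zero.1 ((mul_eq_zero.1 h1).resolve_left h2)
  have first : ∀ γ ∈ S, f β γ - f β (γ - α) = 0 := by
    refine eq_zero_of_shift_invariant (φ := fun γ => f β γ - f β (γ - α)) ?_ hα stab second
    refine ((h.finite β).union ((h.finite β).image (· + α))).subset fun γ hγ => ?_
    by_contra hn
    simp only [Set.mem_union, Set.mem_image, Function.mem_support, not_or, not_exists, not_and,
      not_not] at hn
    refine hγ ?_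
    have h1 : f β (γ - α) = 0 := by
      by_contra h2
      exact hn.2 _ h2 (sub_add_cancel _ _)
    simp [h1, hn.1]
  intro γ h0 hne
  exact eq_zero_of_shift_invariant (h.finite β) hα stab
    (fun γ hγ => (sub_eq_zero.1 (first γ hγ)).symm) γ ⟨h0, hne⟩

open Classical in
/-- The sum of `f μ` over a coset of `ℤμ` off the line through `μ` vanishes. -/
theorem pair_coset (h : IsDetCocycle f B) {μ β : Γ} (hb : det μ β ≠ 0) {γ : Γ}
    (hγ : det μ γ ≠ 0) :
    ∑ᶠ δ, (if ∃ k : ℤ, δ = γ + k • μ then 1 else 0) * f μ δ = 0 := by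
  refine h.pair_periodic (χ := fun δ => if ∃ k : ℤ, δ = γ + k • μ then 1 else 0) hb ?_ ?_
  · intro δ
    have : (∃ k : ℤ, δ + μ = γ + k • μ) ↔ ∃ k : ℤ, δ = γ + k • μ := by
      constructor
      · rintro ⟨k, hk⟩
        exact ⟨k - 1, by rw [sub_smul, one_smul, ← add_sub_assoc, ← hk, add_sub_cancel_right]⟩
      · rintro ⟨k, hk⟩
        exact ⟨k + 1, by rw [add_smul, one_smul, ← add_assoc, ← hk]⟩
    simp only [this]
  · intro δ hδ
    refine if_neg ?_
    rintro ⟨k, rfl⟩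
    exact hγ (by simpa [det_add_right, det_zsmul_right, det_self] using hδ)

/-- If `f α` and `f β` are supported on the lines through `α` and `β`, then `f μ = 0` for `μ`
on neither line. -/
theorem eq_zero_of_generic (h : IsDetCocycle f B) {α β : Γ} (hb : det α β ≠ 0)
    (hα : ∀ γ, det α γ ≠ 0 → f α γ = 0) (hβ : ∀ γ, det β γ ≠ 0 → f β γ = 0) {μ : Γ}
    (hμα : det α μ ≠ 0) (hμβ : det β μ ≠ 0) (γ : Γ) : f μ γ = 0 := by
  classical
  by_contra hne
  -- Intersecting the strips for `α` and `β` leaves four points: `0`, `μ` and the components of `μ`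
  -- along `α` and `β`. The first two are excluded by the normalization of `f`.
  have supp : ∀ δ, f μ δ ≠ 0 →
      (det α δ = 0 ∧ det β δ = det β μ) ∨ (det α δ = det α μ ∧ det β δ = 0) := by
    intro δ hδ
    have h1 : det α δ = 0 ∨ det α δ = det α μ := by
      by_contra hn
      exact hδ (h.eq_zero_of_det_ne hμα hα δ (fun h => hn (Or.inl h)) fun h => hn (Or.inr h))
    have h2 : det β δ = 0 ∨ det β δ = det β μ := by
      by_contra hn
      exact hδ (h.eq_zero_of_det_ne hμβ hβ δ (fun h => hn (Or.inl h)) fun h => hn (Or.inr h))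
    rcases h1 with h1 | h1 <;> rcases h2 with h2 | h2
    · have := eq_zero_of_det_eq_zero hb h1 h2
      exact absurd (by rw [this, h.zero_right]) hδ
    · exact Or.inl ⟨h1, h2⟩
    · exact Or.inr ⟨h1, h2⟩
    · have : δ - μ = 0 := eq_zero_of_det_eq_zero hb (by rw [det_sub_right, h1, sub_self])
        (by rw [det_sub_right, h2, sub_self])
      exact absurd (by rw [sub_eq_zero.1 this, h.self]) hδ
  have hdet : det μ γ ≠ 0 := by
    intro h0
    have e := det_mul_det α β μ γ
    rw [h0, mul_zero] at e
    rcases supp γ hne with ⟨h1, h2⟩ | ⟨h1, h2⟩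
    · rw [h1, h2, mul_zero, sub_zero] at e
      exact mul_ne_zero hμα hμβ e.symm
    · rw [h1, h2, mul_zero, zero_sub] at e
      exact neg_ne_zero.2 (mul_ne_zero hμβ hμα) e.symm
  -- The two components of `μ` are independent, so they do not differ by a multiple of `μ`. The
  -- coset `γ + ℤμ` thus meets the support in `γ` alone, and its sum is `f μ γ`.
  have key := h.pair_coset hdet hdet
  rw [finsum_eq_single _ γ] at key
  · rw [if_pos ⟨0, by simp⟩, one_mul] at key
    exact hne key
  · intro δ hδ
    by_cases hδf : f μ δ = 0
    · rw [hδf, mul_zero]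
    rw [if_neg, zero_mul]
    rintro ⟨k, rfl⟩
    have hk : k ≠ 0 := by rintro rfl; simp at hδ
    have hk' : (k : ℂ) ≠ 0 := Int.cast_ne_zero.2 hk
    have h3 := supp _ hδf
    simp only [det_add_right, det_zsmul_right] at h3
    rcases supp γ hne with ⟨h1, h2⟩ | ⟨h1, h2⟩ <;> rcases h3 with ⟨h3, h4⟩ | ⟨h3, h4⟩
    · rw [h1, zero_add] at h3
      exact mul_ne_zero hk' hμα h3
    · rw [h1, zero_add, mul_eq_right₀ hμα] at h3
      rw [h2, h3, one_mul, ← two_mul] at h4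
      exact mul_ne_zero two_ne_zero hμβ h4
    · rw [h2, zero_add, mul_eq_right₀ hμβ] at h4
      rw [h1, h4, one_mul, ← two_mul] at h3
      exact mul_ne_zero two_ne_zero hμα h3
    · rw [h2, zero_add] at h4
      exact mul_ne_zero hk' hμβ h4

/-- An arbitrary nonzero `μ` is a sum `ν + (μ - ν)` of two independent generic elements, where `f`
already vanishes. The choice of `ν` also keeps `γ` away from both summands, so no `B` term appears.
-/
theorem eq_zero_of_parallel (h : IsDetCocycle f B) {α β : Γ} (hb : det α β ≠ 0)
    (hα : ∀ γ, det α γ ≠ 0 → f α γ = 0) (hβ : ∀ γ, det β γ ≠ 0 → f β γ = 0) (μ γ : Γ) :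
    f μ γ = 0 := by
  by_cases hμ : μ = 0
  · rw [hμ, h.zero_left]
  have hba : det β α ≠ 0 := by rw [det_swap]; exact neg_ne_zero.2 hb
  obtain ⟨l, hl⟩ := (eventually_mul_notMem hb
    (Set.toFinite {0, det α μ, det α γ, det α (μ - γ)})).exists
  simp only [Set.mem_insert_iff, Set.mem_singleton_iff, not_or] at hl
  obtain ⟨k, hk, hk'⟩ : ∃ k : ℕ, (k : ℂ) * det β α ∉ ({0, det β μ} : Set ℂ) ∧
      (k : ℂ) * det α μ + l * det β μ ≠ 0 := by
    by_cases hA : det α μ = 0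
    · obtain ⟨k, hk⟩ := (eventually_mul_notMem hba (Set.toFinite {0, det β μ})).exists
      refine ⟨k, hk, ?_⟩
      rw [hA, mul_zero, zero_add]
      exact mul_ne_zero (left_ne_zero_of_mul hl.1) fun h => hμ (eq_zero_of_det_eq_zero hb hA h)
    · obtain ⟨k, hk, hk'⟩ := ((eventually_mul_notMem hba (Set.toFinite {0, det β μ})).and
        (eventually_mul_notMem hA (Set.toFinite {-(l * det β μ)}))).exists
      exact ⟨k, hk, fun h => hk' (eq_neg_of_add_eq_zero_left h)⟩
  simp only [Set.mem_insert_iff, Set.mem_singleton_iff, not_or] at hk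
  set ν : Γ := k • α + l • β with hν
  have hαν : det α ν = l * det α β := by
    simp [hν, det_add_right, det_nsmul_right, det_self]
  have hβν : det β ν = k * det β α := by
    simp [hν, det_add_right, det_nsmul_right, det_self]
  have hνμ : det ν (μ - ν) ≠ 0 := by
    rw [det_sub_right, det_self, sub_zero, hν, det_add_left, det_nsmul_left, det_nsmul_left]
    exact hk'
  have z1 : ∀ δ, f ν δ = 0 := h.eq_zero_of_generic hb hα hβ (by rw [hαν]; exact hl.1)
    (by rw [hβν]; exact hk.1)
  have z2 : ∀ δ, f (μ - ν) δ = 0 := h.eq_zero_of_generic hb hα hβ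
    (by rw [det_sub_right, hαν]; exact sub_ne_zero.2 (Ne.symm hl.2.1))
    (by rw [det_sub_right, hβν]; exact sub_ne_zero.2 (Ne.symm hk.2))
  have e := h.eq_of_ne (α := ν) (β := μ - ν) (γ := γ)
    (by intro h1; exact hl.2.2.1 (by rw [h1, hαν]))
    (by intro h1; exact hl.2.2.2 (by rw [h1, sub_sub_cancel, hαν]))
  simp only [z1, z2, mul_zero, sub_zero, add_zero, add_sub_cancel] at e
  exact (mul_eq_zero.1 e).resolve_left hνμ

/-- Both `f α` and `f β` may be moved to the lines through `α` and `β`. -/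
theorem exists_coboundary_two (h : IsDetCocycle f B) {α β : Γ} (hb : det α β ≠ 0)
    (hα : ∀ γ, det α γ ≠ 0 → f α γ = 0) :
    ∃ c : Γ →₀ ℂ, (∀ γ, det α γ ≠ 0 → c γ = 0) ∧
      ∀ γ, det β γ ≠ 0 → f β γ = det β γ * (c (γ - β) - c γ) := by
  classical
  have hβα : det β α ≠ 0 := by rw [det_swap]; exact neg_ne_zero.2 hb
  have supp := h.eq_zero_of_det_ne hb hα
  -- Each coset `γ + ℤβ` meets the two strips supporting `f β` only in `γ` and `γ + β`.
  have sum0 : ∀ γ, det α γ = 0 → γ ≠ 0 → f β γ + f β (γ + β) = 0 := by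
    intro γ h0 hγ
    have hβγ : det β γ ≠ 0 := fun h1 => hγ (eq_zero_of_det_eq_zero hb h0 h1)
    have hβ0 : β ≠ 0 := by rintro rfl; exact hβγ (det_zero_left _)
    have key := h.pair_coset hβα hβγ
    rw [finsum_eq_sum_of_support_subset (s := {γ, γ + β}), Finset.sum_pair] at key
    · rwa [if_pos ⟨0, by simp⟩, if_pos ⟨1, by simp⟩, one_mul, one_mul] at key
    · simpa using hβ0
    · intro δ hδ
      have h1 := left_ne_zero_of_mul hδ
      have h2 := right_ne_zero_of_mul hδ
      simp only [ne_eq, ite_eq_right_iff, one_ne_zero, imp_false, not_not] at h1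
      obtain ⟨k, rfl⟩ := h1
      have h3 : det α (γ + k • β) = k * det α β := by
        rw [det_add_right, h0, det_zsmul_right, zero_add]
      by_cases hk0 : k = 0
      · simp [hk0]
      by_cases hk1 : k = 1
      · simp [hk1]
      refine absurd (supp _ ?_ ?_) h2
      · rw [h3]; exact mul_ne_zero (Int.cast_ne_zero.2 hk0) hb
      · rw [h3]
        intro h4
        exact hk1 (by exact_mod_cast (mul_eq_right₀ hb).1 h4)
  -- On the line of `α` the term `c (γ - β)` drops out, which dictates this `c`; `sum0` gives the
  -- other strip. Support on the line of `α` keeps `f α` normalized.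
  refine ⟨Finsupp.ofSupportFinite
    (fun γ => if det α γ = 0 then -(f β γ / det β γ) else 0) ?_, ?_, ?_⟩
  · refine (h.finite β).subset fun γ hγ h0 => hγ ?_
    simp [h0]
  · intro γ hγ
    exact if_neg hγ
  · intro γ hγ
    simp only [Finsupp.ofSupportFinite_coe]
    by_cases h0 : det α γ = 0
    · rw [if_pos h0, if_neg (by rw [det_sub_right, h0, zero_sub]; exact neg_ne_zero.2 hb)]
      field_simp
      ring
    · by_cases h1 : det α γ = det α β
      · rw [if_neg h0, if_pos (by rw [det_sub_right, h1, sub_self])]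
        have h2 := sum0 (γ - β) (by rw [det_sub_right, h1, sub_self])
          (by intro h3; rw [sub_eq_zero.1 h3] at hγ; exact hγ (det_self _))
        rw [sub_add_cancel] at h2
        rw [det_sub_right, det_self, sub_zero]
        field_simp
        linear_combination det β γ * h2
      · rw [if_neg h0, if_neg (by rw [det_sub_right]; exact sub_ne_zero.2 h1), supp γ h0 h1]
        ring

/-- Every cocycle in coordinates is a coboundary. -/
theorem exists_eq_coboundary (h : IsDetCocycle f B) {α β : Γ} (hb : det α β ≠ 0) :
    (∃ c : Γ →₀ ℂ, ∀ μ γ, f μ γ = det μ γ * (c (γ - μ) - c γ)) ∧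
      ∀ μ ν, μ ≠ ν → B μ ν = 0 := by
  obtain ⟨c, hc⟩ := h.exists_coboundary hb
  have h' := h.sub_coboundary c
  have hα' : ∀ γ, det α γ ≠ 0 → f α γ - det α γ * (c (γ - α) - c γ) = 0 := fun γ hγ => by
    rw [hc γ hγ, sub_self]
  obtain ⟨c', hc', hc''⟩ := h'.exists_coboundary_two hb hα'
  have h'' := h'.sub_coboundary c'
  have key := h''.eq_zero_of_parallel hb
    (fun γ hγ => by
      rw [hα' γ hγ, hc' γ hγ, hc' (γ - α) (by rwa [det_sub_right, det_self, sub_zero])]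
      ring)
    (fun γ hγ => by rw [hc'' γ hγ, sub_self])
  refine ⟨⟨c + c', fun μ γ => ?_⟩, fun μ ν hμν => ?_⟩
  · simp only [Finsupp.add_apply]
    linear_combination key μ γ
  -- Coboundaries leave `B` unchanged, so once `f` is zero the equation at `γ = μ` isolates `B μ ν`.
  · have e := h''.eq μ ν μ
    simp only [key] at e
    simpa [hμν] using e

end IsDetCocycle

/-! ### Coordinate functionals -/

open Classical in
/-- The coefficient of `L_γ`; it is zero for `γ = 0`. -/
def coefL (γ : Γ) : GVir Γ →ₗ[ℂ] ℂ :=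
  (basis Γ).constr ℂ (Sum.elim (fun α => if α.1 = γ then 1 else 0) fun _ => 0)

/-- The coefficient of `∂ᵢ`. -/
def coefD (i : Fin 2) : GVir Γ →ₗ[ℂ] ℂ :=
  (basis Γ).constr ℂ (Sum.elim (fun _ => 0) fun j => if j = i then 1 else 0)

open Classical in
theorem coefL_L (γ α : Γ) : coefL γ (L α) = if α = γ ∧ α ≠ 0 then 1 else 0 := by
  by_cases hα : α = 0
  · simp [hα, L_zero]
  · rw [← basis_inl ⟨α, hα⟩]
    simp [coefL, Module.Basis.constr_basis, hα]

theorem coefL_L_self {γ : Γ} (hγ : γ ≠ 0) : coefL γ (L γ) = 1 := by simp [coefL_L, hγ]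

theorem coefL_L_of_ne {γ α : Γ} (h : α ≠ γ) : coefL γ (L α) = 0 := by simp [coefL_L, h]

theorem coefL_d (γ : Γ) (i : Fin 2) : coefL γ (d i) = 0 := by
  rw [← basis_inr]; simp [coefL, Module.Basis.constr_basis]

theorem coefD_L (i : Fin 2) (α : Γ) : coefD i (L α) = 0 := by
  by_cases hα : α = 0
  · simp [hα, L_zero]
  · rw [← basis_inl ⟨α, hα⟩]
    simp [coefD, Module.Basis.constr_basis]

theorem coefD_d (i j : Fin 2) : coefD i (d j : GVir Γ) = if j = i then 1 else 0 := by
  rw [← basis_inr]; simp [coefD, Module.Basis.constr_basis]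

theorem coefL_zero : coefL (0 : Γ) = 0 := by
  refine (basis Γ).ext fun i => ?_
  rcases i with α | i
  · rw [basis_inl, coefL_L_of_ne α.2]; rfl
  · rw [basis_inr, coefL_d]; rfl

theorem induction_on {p : GVir Γ → Prop} (hL : ∀ α : Γ, α ≠ 0 → p (L α)) (hd : ∀ i, p (d i))
    (h0 : p 0) (hadd : ∀ x y, p x → p y → p (x + y)) (hsmul : ∀ (t : ℂ) x, p x → p (t • x))
    (x : GVir Γ) : p x := by
  have hx := (basis Γ).mem_span x
  induction hx using Submodule.span_induction with
  | mem x h =>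
    obtain ⟨i, rfl⟩ := h
    rcases i with α | i
    · rw [basis_inl]; exact hL _ α.2
    · exact hd i
  | zero => exact h0
  | add x y _ _ hx hy => exact hadd x y hx hy
  | smul t x _ hx => exact hsmul t x hx

theorem hom_ext {M : Type*} [AddCommGroup M] [Module ℂ M] {φ ψ : GVir Γ →ₗ[ℂ] M}
    (hL : ∀ α : Γ, α ≠ 0 → φ (L α) = ψ (L α)) (hd : ∀ i, φ (d i) = ψ (d i)) : φ = ψ := by
  refine LinearMap.ext fun x => ?_
  induction x using induction_on with
  | hL α h => exact hL α h
  | hd i => exact hd i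
  | h0 => simp
  | hadd x y hx hy => rw [map_add, map_add, hx, hy]
  | hsmul t x hx => rw [map_smul, map_smul, hx]

theorem coord_inl (α : {α : Γ // α ≠ 0}) : (basis Γ).coord (Sum.inl α) = coefL α.1 := by
  classical
  refine (basis Γ).ext fun j => ?_
  rcases j with β | j <;>
    simp [coefL, Module.Basis.constr_basis, Finsupp.single_apply, Subtype.val_inj]

theorem coord_inr (i : Fin 2) : (basis Γ).coord (Sum.inr i) = coefD i := by
  refine (basis Γ).ext fun j => ?_
  rcases j with β | j <;> simp [coefD, Module.Basis.constr_basis, Finsupp.single_apply]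

theorem eq_zero_of_coef {x : GVir Γ} (hL : ∀ γ, coefL γ x = 0) (hd : ∀ i, coefD i x = 0) :
    x = 0 := by
  refine (basis Γ).ext_elem fun i => ?_
  rw [map_zero, Finsupp.zero_apply, ← Module.Basis.coord_apply]
  rcases i with α | i
  · rw [coord_inl, hL]
  · rw [coord_inr, hd]

theorem coefL_finite (x : GVir Γ) : {γ | coefL γ x ≠ 0}.Finite := by
  induction x using induction_on with
  | hL α h =>
    refine (Set.finite_singleton α).subset fun γ hγ => ?_
    by_contra hne
    exact hγ (coefL_L_of_ne (Ne.symm hne))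
  | hd i => simp [coefL_d]
  | h0 => simp
  | hadd x y hx hy =>
    refine (hx.union hy).subset fun γ hγ => ?_
    by_contra hn
    simp only [Set.mem_union, Set.mem_ofPred_eq, not_or, not_not] at hn
    exact hγ (by rw [map_add, hn.1, hn.2, add_zero])
  | hsmul t x hx =>
    refine hx.subset fun γ hγ h => hγ ?_
    rw [map_smul, h, smul_zero]

theorem lie_L_d (α : Γ) (i : Fin 2) : ⁅L α, (d i : GVir Γ)⁆ = -((α : Fin 2 → ℂ) i • L α) :=
  br_L_d α i

theorem lie_L_L' (α β : Γ) : ⁅L α, L β⁆ = det α β • L (α + β) := br_L_L α β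

/-- The pairing `x ↦ ∑ αᵢ xᵢ` with the coefficients of `∂₁`, `∂₂`. -/
def dotD (α : Γ) : GVir Γ →ₗ[ℂ] ℂ :=
  (α : Fin 2 → ℂ) 0 • coefD 0 + (α : Fin 2 → ℂ) 1 • coefD 1

theorem dotD_L (α β : Γ) : dotD α (L β) = 0 := by simp [dotD, coefD_L]

theorem dotD_d (α : Γ) (i : Fin 2) : dotD α (d i) = (α : Fin 2 → ℂ) i := by
  fin_cases i <;> simp [dotD, coefD_d]

-- The transpose of `ad L_α` on coefficients. The correction at `γ = α` records `[L_α, ∂ᵢ] = -αᵢ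
-- L_α` and is the origin of the `B` terms.
open Classical in
theorem coefL_comp_ad (α γ : Γ) : coefL γ ∘ₗ (LieAlgebra.ad ℂ (GVir Γ) (L α)) =
    det α γ • coefL (γ - α) - (if γ = α then (1 : ℂ) else 0) • dotD α := by
  refine hom_ext (fun β hβ => ?_) fun i => ?_
  · simp only [LinearMap.comp_apply, LieAlgebra.ad_apply, lie_L_L', map_smul, LinearMap.sub_apply,
      LinearMap.smul_apply, dotD_L, smul_eq_mul, mul_zero, sub_zero]
    by_cases h : β = γ - α
    · subst h
      rw [coefL_L_self hβ, add_sub_cancel, det_sub_right, det_self, sub_zero]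
      by_cases h0 : γ = 0
      · simp [h0, det_zero_right]
      · rw [coefL_L_self h0]
    · rw [coefL_L_of_ne h, coefL_L_of_ne (fun h' => h (eq_sub_of_add_eq' h')), mul_zero,
        mul_zero]
  · simp only [LinearMap.comp_apply, LieAlgebra.ad_apply, lie_L_d, map_smul, LinearMap.sub_apply,
      LinearMap.smul_apply, dotD_d, smul_eq_mul, map_neg, coefL_d, mul_zero,
      zero_sub]
    by_cases h : γ = α
    · subst h
      by_cases h0 : γ = 0
      · simp [h0, L_zero]
      · rw [coefL_L_self h0, if_pos rfl]; ring
    · rw [coefL_L_of_ne (Ne.symm h), if_neg h]; ring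

theorem coefD_comp_ad_L (i : Fin 2) (α : Γ) :
    coefD i ∘ₗ (LieAlgebra.ad ℂ (GVir Γ) (L α)) = 0 := by
  refine hom_ext (fun β _ => ?_) fun j => ?_
  · simp [lie_L_L', coefD_L]
  · simp [lie_L_d, coefD_L]

theorem coefD_comp_ad_d (i j : Fin 2) :
    coefD i ∘ₗ (LieAlgebra.ad ℂ (GVir Γ) (d j)) = 0 := by
  refine hom_ext (fun β _ => ?_) fun k => ?_
  · simp [lie_d_L, coefD_L]
  · simp [lie_d_d]

theorem coefL_comp_ad_d (γ : Γ) (i : Fin 2) :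
    coefL γ ∘ₗ (LieAlgebra.ad ℂ (GVir Γ) (d i)) = (γ : Fin 2 → ℂ) i • coefL γ := by
  refine hom_ext (fun β _ => ?_) fun k => ?_
  · by_cases h : β = γ
    · subst h; simp [lie_d_L]
    · simp [lie_d_L, coefL_L_of_ne h]
  · simp [lie_d_d, coefL_d]

theorem coefL_lie_L (α γ : Γ) (h : γ ≠ α) (x : GVir Γ) :
    coefL γ ⁅L α, x⁆ = det α γ * coefL (γ - α) x := by
  have := LinearMap.congr_fun (coefL_comp_ad α γ) x
  simpa [h] using this

/-! ### Invariants -/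

theorem exists_det_ne_zero (hΓ : Nondegenerate Γ) :
    ∃ α β : Γ, det α β ≠ 0 := by
  obtain ⟨b, hb⟩ := hΓ
  refine ⟨⟨b 0, hb 0⟩, ⟨b 1, hb 1⟩, fun h => ?_⟩
  have h1 : (b 1 1) • b 0 = (b 0 1) • b 1 := by
    ext i
    simp only [det] at h
    fin_cases i
    · simp only [Fin.zero_eta, Pi.smul_apply, smul_eq_mul]; linear_combination h
    · simp only [Fin.mk_one, Pi.smul_apply, smul_eq_mul]; ring
  have h2 : (b 1 0) • b 0 = (b 0 0) • b 1 := by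
    ext i
    simp only [det] at h
    fin_cases i
    · simp only [Fin.zero_eta, Pi.smul_apply, smul_eq_mul]; ring
    · simp only [Fin.mk_one, Pi.smul_apply, smul_eq_mul]; linear_combination -h
  have li := b.linearIndependent
  have e1 := LinearIndependent.pair_iff.1 (show LinearIndependent ℂ ![b 0, b 1] by
    convert li using 1; ext i; fin_cases i <;> rfl)
  have e2 := e1 (b 1 1) (-(b 0 1)) (by rw [h1]; simp)
  have e3 := e1 (b 1 0) (-(b 0 0)) (by rw [h2]; simp)
  refine b.ne_zero 1 ?_
  ext i
  fin_cases i
  · exact e3.1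
  · exact e2.1

theorem exists_det_ne_zero_of_ne_zero (hΓ : Nondegenerate Γ) {γ : Γ} (hγ : γ ≠ 0) :
    ∃ α : Γ, det α γ ≠ 0 := by
  obtain ⟨α, β, hb⟩ := exists_det_ne_zero hΓ
  by_contra! hn
  exact hγ (eq_zero_of_det_eq_zero hb (hn α) (hn β))

/-- A finite-dimensional ideal is zero. -/
theorem eq_zero_of_mem_ideal (hΓ : Nondegenerate Γ) {I : Submodule ℂ (GVir Γ)}
    [FiniteDimensional ℂ I] (hI : ∀ x : GVir Γ, ∀ y ∈ I, ⁅x, y⁆ ∈ I) {x : GVir Γ} (hx : x ∈ I) :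
    x = 0 := by
  -- the supports of the elements of `I` are contained in a common finite set
  have hfin : {γ : Γ | ∃ y ∈ I, coefL γ y ≠ 0}.Finite := by
    have hfg : I.FG := (Submodule.fg_iff_finiteDimensional I).2 inferInstance
    obtain ⟨S, hS⟩ := hfg
    refine (S.finite_toSet.biUnion fun y _ => coefL_finite y).subset ?_
    rintro γ ⟨y, hy, hne⟩
    by_contra hn
    simp only [Set.mem_iUnion, Set.mem_ofPred_eq, not_exists, not_not] at hn
    have : Submodule.span ℂ (S : Set (GVir Γ)) ≤ LinearMap.ker (coefL γ) :=
      Submodule.span_le.2 fun z hz => hn z hz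
    exact hne (this (hS ▸ hy))
  have hL : ∀ y ∈ I, ∀ γ, coefL γ y = 0 := by
    intro y hy γ
    by_contra hne
    have hγ : γ ≠ 0 := by rintro rfl; exact hne (by rw [coefL_zero]; rfl)
    obtain ⟨α, hα⟩ := exists_det_ne_zero_of_ne_zero hΓ hγ
    have hα0 : α ≠ 0 := by rintro rfl; exact hα (det_zero_left _)
    -- Bracketing with `L_{(n+1)α}` carries a nonzero coefficient at `γ` to `γ + (n+1)α`, with
    -- factor `(n+1) det α γ ≠ 0`. Using `n + 1` avoids the zero multiple.
    refine Set.infinite_of_injective_forall_mem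
      (f := fun n : ℕ => γ + (n + 1) • α) ?_ ?_ hfin
    · intro m n h
      exact Nat.succ_injective (nsmul_left_injective hα0 (add_left_cancel h))
    · intro n
      refine ⟨⁅L ((n + 1) • α), y⁆, hI _ _ hy, ?_⟩
      rw [coefL_lie_L _ _ (by simpa using hγ), add_sub_cancel_right, det_add_right,
        det_nsmul_left, det_self, add_zero]
      exact mul_ne_zero (mul_ne_zero (Nat.cast_ne_zero.2 n.succ_ne_zero) hα) hne
  refine eq_zero_of_coef (hL x hx) ?_
  -- With no `L`-coefficients left in the ideal, the `L_α`-coefficient of `[L_α, x]` reads off the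
  -- `∂`-part of `x`.
  have hdot : ∀ α : Γ, dotD α x = 0 := by
    intro α
    by_cases h0 : α = 0
    · simp [h0, dotD]
    have h := LinearMap.congr_fun (coefL_comp_ad α α) x
    have h' : coefL α ⁅L α, x⁆ = 0 := hL _ (hI _ _ hx) α
    simp only [LinearMap.comp_apply, LieAlgebra.ad_apply, h', det_self, zero_smul, zero_sub,
      if_true, one_smul, LinearMap.neg_apply] at h
    exact neg_eq_zero.1 h.symm
  obtain ⟨α, β, hb⟩ := exists_det_ne_zero hΓ
  have h1 := hdot α
  have h2 := hdot β
  simp only [dotD, LinearMap.add_apply, LinearMap.smul_apply, smul_eq_mul] at h1 h2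
  intro i
  refine (mul_eq_zero.1 (?_ : det α β * coefD i x = 0)).resolve_left hb
  simp only [det]
  fin_cases i
  · simp only [Fin.zero_eta]; linear_combination β.1 1 * h1 - α.1 1 * h2
  · simp only [Fin.mk_one]; linear_combination α.1 0 * h2 - β.1 0 * h1

theorem eq_zero_of_central (hΓ : Nondegenerate Γ) (x : GVir Γ) (hx : ∀ y : GVir Γ, ⁅x, y⁆ = 0) :
    x = 0 := by
  refine eq_zero_of_mem_ideal hΓ (I := Submodule.span ℂ {x}) ?_
    (Submodule.mem_span_singleton_self x)
  intro y z hz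
  obtain ⟨t, rfl⟩ := Submodule.mem_span_singleton.1 hz
  rw [lie_smul, ← lie_skew, hx y, neg_zero, smul_zero]
  exact zero_mem _

/-- `L ⊗ M` has no invariants, for every `L`-module `M`. -/
theorem eq_zero_of_invariant (hΓ : Nondegenerate Γ) {M : Type*} [AddCommGroup M] [Module ℂ M]
    [LieRingModule (GVir Γ) M] [LieModule ℂ (GVir Γ) M] (w : GVir Γ ⊗[ℂ] M)
    (hw : ∀ x : GVir Γ, ⁅x, w⁆ = 0) : w = 0 := by
  let T : (M →ₗ[ℂ] ℂ) →ₗ[ℂ] (GVir Γ ⊗[ℂ] M →ₗ[ℂ] GVir Γ) :=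
    (LinearMap.llcomp ℂ _ _ _ (TensorProduct.rid ℂ (GVir Γ)).toLinearMap) ∘ₗ
      LinearMap.lTensorHom (GVir Γ)
  have hT : ∀ φ x m, T φ (x ⊗ₜ m) = φ m • x := fun φ x m => by simp [T]
  have hlie : ∀ (x : GVir Γ) (φ : M →ₗ[ℂ] ℂ) (v : GVir Γ ⊗[ℂ] M), ⁅x, T φ v⁆
      = T φ ⁅x, v⁆ - T (φ ∘ₗ LieModule.toEnd ℂ (GVir Γ) M x) v := by
    intro x φ v
    induction v using TensorProduct.induction_on with
    | zero => simp
    | add u v hu hv => simp only [map_add, lie_add, hu, hv]; abel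
    | tmul a m => simp [hT]
  -- All contractions of `w`. Invariance trades the bracket on the first factor for minus the action
  -- on the functional, so this is an ideal.
  let I : Submodule ℂ (GVir Γ) := LinearMap.range (T.flip w)
  have hfd : FiniteDimensional ℂ I := by
    have : ∃ J : Submodule ℂ (GVir Γ), FiniteDimensional ℂ J ∧ ∀ φ, T φ w ∈ J := by
      clear hw I
      induction w using TensorProduct.induction_on with
      | zero => exact ⟨⊥, inferInstance, fun φ => by simp⟩
      | tmul a m =>
        refine ⟨Submodule.span ℂ {a}, inferInstance, fun φ => ?_⟩
        rw [hT]
        exact Submodule.smul_mem _ _ (Submodule.mem_span_singleton_self a)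
      | add u v hu hv =>
        obtain ⟨J, hJ, hu⟩ := hu
        obtain ⟨K, hK, hv⟩ := hv
        refine ⟨J ⊔ K, inferInstance, fun φ => ?_⟩
        rw [map_add]
        exact add_mem (Submodule.mem_sup_left (hu φ)) (Submodule.mem_sup_right (hv φ))
    obtain ⟨J, hJ, h⟩ := this
    refine Submodule.finiteDimensional_of_le (S₂ := J) ?_
    rintro _ ⟨φ, rfl⟩
    exact h φ
  have hI : ∀ x : GVir Γ, ∀ y ∈ I, ⁅x, y⁆ ∈ I := by
    rintro x _ ⟨φ, rfl⟩
    refine ⟨-(φ ∘ₗ LieModule.toEnd ℂ (GVir Γ) M x), ?_⟩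
    rw [LinearMap.flip_apply, LinearMap.flip_apply, hlie, hw, map_zero, map_neg,
      LinearMap.neg_apply, zero_sub]
  have hzero : ∀ φ, T φ w = 0 := fun φ => eq_zero_of_mem_ideal hΓ hI ⟨φ, rfl⟩
  classical
  let bM := Module.Basis.ofVectorSpace ℂ M
  refine (TensorProduct.equivFinsuppOfBasisRight bM (M := GVir Γ)).injective ?_
  rw [map_zero]
  ext i : 1
  rw [Finsupp.zero_apply, ← hzero (bM.coord i)]
  clear hw hzero I hfd hI
  induction w using TensorProduct.induction_on with
  | zero => simp
  | add u v hu hv => simp only [map_add, Finsupp.add_apply, hu, hv]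
  | tmul a m => simp [hT]

/-! ### Coordinates and weights on `L ⊗ L` -/

/-- The functional `φ ⊗ ψ` on `L ⊗ L`. -/
def coef₂ (φ ψ : GVir Γ →ₗ[ℂ] ℂ) : GVir Γ ⊗[ℂ] GVir Γ →ₗ[ℂ] ℂ :=
  LinearMap.mul' ℂ ℂ ∘ₗ TensorProduct.map φ ψ

theorem coef₂_tmul (φ ψ : GVir Γ →ₗ[ℂ] ℂ) (x y : GVir Γ) :
    coef₂ φ ψ (x ⊗ₜ y) = φ x * ψ y := rfl

theorem coef₂_lie (φ ψ : GVir Γ →ₗ[ℂ] ℂ) (x : GVir Γ) (w : GVir Γ ⊗[ℂ] GVir Γ) :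
    coef₂ φ ψ ⁅x, w⁆ = coef₂ (φ ∘ₗ LieAlgebra.ad ℂ (GVir Γ) x) ψ w
      + coef₂ φ (ψ ∘ₗ LieAlgebra.ad ℂ (GVir Γ) x) w := by
  induction w using TensorProduct.induction_on with
  | zero => simp
  | add u v hu hv => simp only [map_add, lie_add, hu, hv]; ring
  | tmul a b => simp [coef₂_tmul]

theorem coef₂_add_left (φ φ' ψ : GVir Γ →ₗ[ℂ] ℂ) :
    coef₂ (φ + φ') ψ = coef₂ φ ψ + coef₂ φ' ψ := by
  rw [coef₂, TensorProduct.map_add_left, LinearMap.comp_add]; rfl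

theorem coef₂_add_right (φ ψ ψ' : GVir Γ →ₗ[ℂ] ℂ) :
    coef₂ φ (ψ + ψ') = coef₂ φ ψ + coef₂ φ ψ' := by
  rw [coef₂, TensorProduct.map_add_right, LinearMap.comp_add]; rfl

theorem coef₂_smul_left (t : ℂ) (φ ψ : GVir Γ →ₗ[ℂ] ℂ) : coef₂ (t • φ) ψ = t • coef₂ φ ψ := by
  rw [coef₂, TensorProduct.map_smul_left, LinearMap.comp_smul]; rfl

theorem coef₂_smul_right (t : ℂ) (φ ψ : GVir Γ →ₗ[ℂ] ℂ) : coef₂ φ (t • ψ) = t • coef₂ φ ψ := by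
  rw [coef₂, TensorProduct.map_smul_right, LinearMap.comp_smul]; rfl

theorem coef₂_sub_left (φ φ' ψ : GVir Γ →ₗ[ℂ] ℂ) :
    coef₂ (φ - φ') ψ = coef₂ φ ψ - coef₂ φ' ψ := by
  rw [eq_sub_iff_add_eq, ← coef₂_add_left, sub_add_cancel]

theorem coef₂_sub_right (φ ψ ψ' : GVir Γ →ₗ[ℂ] ℂ) :
    coef₂ φ (ψ - ψ') = coef₂ φ ψ - coef₂ φ ψ' := by
  rw [eq_sub_iff_add_eq, ← coef₂_add_right, sub_add_cancel]

theorem coef₂_zero_left (ψ : GVir Γ →ₗ[ℂ] ℂ) : coef₂ 0 ψ = 0 := by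
  simpa using coef₂_smul_left 0 0 ψ

theorem coef₂_zero_right (φ : GVir Γ →ₗ[ℂ] ℂ) : coef₂ φ 0 = 0 := by
  simpa using coef₂_smul_right 0 φ 0

theorem coef₂_finite (w : GVir Γ ⊗[ℂ] GVir Γ) :
    ∃ T : Set Γ, T.Finite ∧ ∀ γ ∉ T, ∀ ψ, coef₂ (coefL γ) ψ w = 0 := by
  induction w using TensorProduct.induction_on with
  | zero => exact ⟨∅, Set.finite_empty, fun γ _ ψ => map_zero _⟩
  | tmul a b =>
    refine ⟨_, coefL_finite a, fun γ hγ ψ => ?_⟩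
    have : coefL γ a = 0 := not_not.1 hγ
    rw [coef₂_tmul, this, zero_mul]
  | add u v hu hv =>
    obtain ⟨S, hS, hu⟩ := hu
    obtain ⟨T, hT, hv⟩ := hv
    refine ⟨S ∪ T, hS.union hT, fun γ hγ ψ => ?_⟩
    rw [map_add, hu γ (fun h => hγ (Or.inl h)), hv γ (fun h => hγ (Or.inr h)), add_zero]

/-- All coefficient functionals, those of `L_γ` and those of `∂ᵢ`. -/
def coef : Γ ⊕ Fin 2 → GVir Γ →ₗ[ℂ] ℂ := Sum.elim coefL coefD

/-- The weight of a basis vector. -/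
def weight : Γ ⊕ Fin 2 → Γ := Sum.elim id fun _ => 0

theorem coef_comp_ad_d (s : Γ ⊕ Fin 2) (i : Fin 2) :
    coef s ∘ₗ (LieAlgebra.ad ℂ (GVir Γ) (d i)) = (weight s : Fin 2 → ℂ) i • coef s := by
  rcases s with γ | j
  · exact coefL_comp_ad_d γ i
  · simp [coef, weight, coefD_comp_ad_d]

theorem coef₂_lie_d (s t : Γ ⊕ Fin 2) (i : Fin 2) (w : GVir Γ ⊗[ℂ] GVir Γ) :
    coef₂ (coef s) (coef t) ⁅(d i : GVir Γ), w⁆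
      = ((weight s + weight t : Γ) : Fin 2 → ℂ) i * coef₂ (coef s) (coef t) w := by
  rw [coef₂_lie, coef_comp_ad_d, coef_comp_ad_d, coef₂_smul_left, coef₂_smul_right]
  simp only [LinearMap.smul_apply, smul_eq_mul, AddSubgroup.coe_add, Pi.add_apply]
  ring

theorem coef₂_ext {w w' : GVir Γ ⊗[ℂ] GVir Γ}
    (h : ∀ s t, coef₂ (coef s) (coef t) w = coef₂ (coef s) (coef t) w') : w = w' := by
  have hb : ∀ i, ∃ s : Γ ⊕ Fin 2, (basis Γ).coord i = coef s := by
    rintro (α | i)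
    · exact ⟨Sum.inl α.1, coord_inl α⟩
    · exact ⟨Sum.inr i, coord_inr i⟩
  refine ((basis Γ).tensorProduct (basis Γ)).ext_elem fun ⟨i, j⟩ => ?_
  have key : ∀ v, ((basis Γ).tensorProduct (basis Γ)).repr v (i, j)
      = coef₂ ((basis Γ).coord i) ((basis Γ).coord j) v := by
    intro v
    induction v using TensorProduct.induction_on with
    | zero => simp
    | add u v hu hv => rw [map_add, map_add, Finsupp.add_apply, hu, hv]
    | tmul a b => 
      rw [Module.Basis.tensorProduct_repr_tmul_apply, coef₂_tmul, smul_eq_mul, mul_comm]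
      rfl
  obtain ⟨s, hs⟩ := hb i
  obtain ⟨t, ht⟩ := hb j
  rw [key, key, hs, ht, h]

/-- `w` has weight `μ` under `∂₁`, `∂₂`. -/
def HasWeight (μ : Γ) (w : GVir Γ ⊗[ℂ] GVir Γ) : Prop :=
  ∀ i, ⁅(d i : GVir Γ), w⁆ = (μ : Fin 2 → ℂ) i • w

theorem HasWeight.coef₂_eq_zero {μ : Γ} {w : GVir Γ ⊗[ℂ] GVir Γ} (hw : HasWeight μ w)
    {s t : Γ ⊕ Fin 2} (h : weight s + weight t ≠ μ) : coef₂ (coef s) (coef t) w = 0 := by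
  by_contra hne
  refine h (Subtype.ext (funext fun i => ?_))
  have e := coef₂_lie_d s t i w
  rw [hw i, map_smul, smul_eq_mul] at e
  exact (mul_right_cancel₀ hne e).symm

theorem HasWeight.lie_L {w : GVir Γ ⊗[ℂ] GVir Γ} (hw : HasWeight (0 : Γ) w) (α : Γ) :
    HasWeight α ⁅L α, w⁆ := by
  intro i
  rw [leibniz_lie, hw i, lie_d_L, smul_lie]
  simp

/-- The diagonal operator multiplying vectors of weight `μ` by `r μ`. -/
theorem exists_diagonal (r : Γ → ℂ) : ∃ R : GVir Γ ⊗[ℂ] GVir Γ →ₗ[ℂ] GVir Γ ⊗[ℂ] GVir Γ,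
    ∀ s t w, coef₂ (coef s) (coef t) (R w)
      = r (weight s + weight t) * coef₂ (coef s) (coef t) w := by
  let wt : {α : Γ // α ≠ 0} ⊕ Fin 2 → Γ := Sum.elim (fun α => α.1) fun _ => 0
  have hwt : ∀ s i, coef s (basis Γ i) ≠ 0 → weight s = wt i := by
    intro s i h
    rcases s with γ | j <;> rcases i with α | i
    · rw [basis_inl] at h
      by_contra hne
      exact h (coefL_L_of_ne (Ne.symm hne))
    · exact absurd (coefL_d γ i) h
    · rw [basis_inl] at h
      exact absurd (coefD_L j _) h
    · rfl
  let b₂ := (basis Γ).tensorProduct (basis Γ)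
  refine ⟨b₂.constr ℂ fun p => r (wt p.1 + wt p.2) • b₂ p, fun s t w => ?_⟩
  have : coef₂ (coef s) (coef t) ∘ₗ (b₂.constr ℂ fun p => r (wt p.1 + wt p.2) • b₂ p)
      = r (weight s + weight t) • coef₂ (coef s) (coef t) := by
    refine b₂.ext fun p => ?_
    simp only [LinearMap.comp_apply, Module.Basis.constr_basis, map_smul, LinearMap.smul_apply,
      smul_eq_mul]
    simp only [b₂, Module.Basis.tensorProduct_apply', coef₂_tmul]
    by_cases h1 : coef s (basis Γ p.1) = 0
    · simp [h1]
    by_cases h2 : coef t (basis Γ p.2) = 0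
    · simp [h2]
    rw [hwt _ _ h1, hwt _ _ h2]
  exact LinearMap.congr_fun this w

/-! ### Derivations with values in `L ⊗ L` -/

/-- `D` is a derivation from the Lie algebra to `L ⊗ L`. -/
def IsDerivation (D : GVir Γ →ₗ[ℂ] GVir Γ ⊗[ℂ] GVir Γ) : Prop :=
  ∀ x y : GVir Γ, D ⁅x, y⁆ = ⁅x, D y⁆ - ⁅y, D x⁆

namespace IsDerivation

variable {D : GVir Γ →ₗ[ℂ] GVir Γ ⊗[ℂ] GVir Γ}

theorem sub_coboundary (hD : IsDerivation D) (u : GVir Γ ⊗[ℂ] GVir Γ) :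
    IsDerivation (D - LieBialg.coboundary u) := by
  intro x y
  simp only [LinearMap.sub_apply, LieBialg.coboundary_apply, hD x y, lie_sub, lie_lie]
  abel

/-- After subtracting an inner derivation, `D(∂ᵢ)` has weight zero. -/
theorem exists_weight_zero (hD : IsDerivation D) :
    ∃ u, ∀ i, HasWeight (0 : Γ) (D (d i) - ⁅(d i : GVir Γ), u⁆) := by
  -- In weight `μ` the relation `∂₁·D(∂₂) = ∂₂·D(∂₁)` makes `D(∂ᵢ)` equal to `μᵢ u` when `μ ≠ 0`.
  -- `R` recovers `u` if `μ₁ ≠ 0`, and `S` does so otherwise. The convention `0⁻¹ = 0` switches `R`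
  -- off when `μ₁ = 0`, and both off at `μ = 0`.
  obtain ⟨R, hR⟩ := exists_diagonal (Γ := Γ) fun μ => (μ.1 0)⁻¹
  obtain ⟨S, hS⟩ := exists_diagonal (Γ := Γ) fun μ => if μ.1 0 = 0 then (μ.1 1)⁻¹ else 0
  refine ⟨R (D (d 0)) + S (D (d 1)), fun i j => coef₂_ext fun s t => ?_⟩
  have comm : ⁅(d 0 : GVir Γ), D (d 1)⁆ = ⁅(d 1 : GVir Γ), D (d 0)⁆ := by
    have h := hD (d 0) (d 1)
    rw [lie_d_d, map_zero] at h
    exact (sub_eq_zero.1 h.symm)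
  have e := congrArg (coef₂ (coef s) (coef t)) comm
  rw [coef₂_lie_d, coef₂_lie_d] at e
  rw [coef₂_lie_d, map_sub, coef₂_lie_d, map_add, hR, hS, AddSubgroup.coe_zero, Pi.zero_apply,
    zero_smul, map_zero]
  generalize weight s + weight t = μ at *
  by_cases h0 : (μ : Fin 2 → ℂ) 0 = 0
  · by_cases h1 : (μ : Fin 2 → ℂ) 1 = 0
    · have : (μ : Fin 2 → ℂ) j = 0 := by fin_cases j <;> assumption
      rw [this, zero_mul]
    · rw [if_pos h0]
      have e0 : coef₂ (coef s) (coef t) (D (d 0)) = 0 := by simpa [h0, h1] using e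
      refine mul_eq_zero_of_right _ ?_
      fin_cases i
      · simp [h0, e0]
      · simp [e0, h1]
  · rw [if_neg h0]
    refine mul_eq_zero_of_right _ ?_
    fin_cases i
    · simp only [Fin.zero_eta]; field_simp; ring
    · simp only [Fin.mk_one]; field_simp; linear_combination e

/-- A derivation with `D(∂ᵢ)` of weight zero kills `∂ᵢ` and preserves weights. -/
theorem of_weight_zero (hΓ : Nondegenerate Γ) (hD : IsDerivation D)
    (h0 : ∀ i, HasWeight (0 : Γ) (D (d i))) :
    (∀ i, D (d i) = 0) ∧ ∀ α : Γ, HasWeight α (D (L α)) := by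
  have key : ∀ (α : Γ) i, ⁅L α, D (d i)⁆ = 0 := by
    intro α i
    refine coef₂_ext fun s t => ?_
    rw [map_zero]
    by_cases h : weight s + weight t = α
    · have e := congrArg (coef₂ (coef s) (coef t)) (hD (d i) (L α))
      rw [lie_d_L, map_smul, map_smul, map_sub, coef₂_lie_d, h, smul_eq_mul] at e
      linear_combination e
    · exact ((h0 i).lie_L α).coef₂_eq_zero h
  have hd : ∀ i, D (d i) = 0 := by
    intro i
    refine eq_zero_of_invariant hΓ _ fun x => ?_
    induction x using induction_on with
    | hL α _ => exact key α i
    | hd j => simpa using h0 i j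
    | h0 => simp
    | hadd x y hx hy => rw [add_lie, hx, hy, add_zero]
    | hsmul t x hx => rw [smul_lie, hx, smul_zero]
  refine ⟨hd, fun α i => ?_⟩
  have e := hD (d i) (L α)
  rw [lie_d_L, map_smul, hd, lie_zero, sub_zero] at e
  exact e.symm

/-- The coordinates of `D(L_μ)` form a cocycle. -/
theorem isDetCocycle (hD : IsDerivation D) :
    IsDetCocycle (fun μ γ => coef₂ (coefL γ) (coefL (μ - γ)) (D (L μ)))
      (fun α β => coef₂ (dotD α) (coefL β) (D (L β)) - coef₂ (coefL α) (dotD β) (D (L α))) where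
  finite μ := by
    obtain ⟨T, hT, h⟩ := coef₂_finite (D (L μ))
    refine hT.subset fun γ hγ => ?_
    by_contra hn
    exact hγ (h γ hn _)
  zero_left γ := by rw [L_zero, map_zero, map_zero]
  zero_right μ := by rw [coefL_zero, coef₂_zero_left]; rfl
  self μ := by rw [sub_self, coefL_zero, coef₂_zero_right]; rfl
  eq α β γ := by
    have e := congrArg (coef₂ (coefL γ) (coefL (α + β - γ))) (hD (L α) (L β))
    have i1 : α + β - γ = α ↔ γ = β := by
      rw [sub_eq_iff_eq_add, add_right_inj, eq_comm]
    have i2 : α + β - γ = β ↔ γ = α := by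
      rw [sub_eq_iff_eq_add, add_comm α β, add_right_inj, eq_comm]
    have j1 : α + β - γ - α = β - γ := by abel
    have j2 : α + β - γ - β = α - γ := by abel
    have j3 : β - (γ - α) = α + β - γ := by abel
    have j4 : α - (γ - β) = α + β - γ := by abel
    rw [lie_L_L', map_smul, map_smul, map_sub, coef₂_lie, coef₂_lie] at e
    simp only [coefL_comp_ad, coef₂_sub_left, coef₂_sub_right, coef₂_smul_left, coef₂_smul_right,
      LinearMap.sub_apply, LinearMap.smul_apply, smul_eq_mul, i1, i2, j1, j2] at e
    simp only [j3, j4, e]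
    by_cases h1 : γ = α
    · by_cases h2 : γ = β
      · subst h1; subst h2; simp
      · subst h1
        simp only [add_sub_cancel_left, if_true, if_neg h2]
        ring
    · by_cases h2 : γ = β
      · subst h2
        simp only [add_sub_cancel_right, if_true, if_neg h1]
        ring
      · simp only [if_neg h1, if_neg h2]
        ring

theorem coefD_add (hD : IsDerivation D) {α β : Γ} (hb : det α β ≠ 0) (i : Fin 2) :
    coef₂ (coefD i) (coefL (α + β)) (D (L (α + β)))
      = coef₂ (coefD i) (coefL α) (D (L α)) + coef₂ (coefD i) (coefL β) (D (L β)) := by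
  have hα : α ≠ 0 := by rintro rfl; exact hb (det_zero_left _)
  have hβ : β ≠ 0 := by rintro rfl; exact hb (det_zero_right _)
  have e := congrArg (coef₂ (coefD i) (coefL (α + β))) (hD (L α) (L β))
  rw [lie_L_L', map_smul, map_smul, map_sub, coef₂_lie, coef₂_lie, coefD_comp_ad_L,
    coefD_comp_ad_L, coefL_comp_ad, coefL_comp_ad, if_neg (by simpa using hβ),
    if_neg (by simpa using hα), zero_smul, zero_smul, sub_zero, sub_zero, coef₂_zero_left,
    coef₂_smul_right, coef₂_smul_right, add_sub_cancel_left, add_sub_cancel_right, det_add_right,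
    det_add_right, det_self, det_self, det_swap α β] at e
  simp only [LinearMap.zero_apply, LinearMap.smul_apply, smul_eq_mul, zero_add, add_zero] at e
  refine mul_left_cancel₀ hb ?_
  linear_combination e

/-- Off the diagonal this is the vanishing of `B`. On the diagonal it is the difference of the
relations for `(α, 2α + β)` and `(α, α + β)`, with `β` independent of `α`, using additivity of the
`∂ᵢ ⊗ L` coordinates. -/
theorem dotD_eq (hΓ : Nondegenerate Γ) (hD : IsDerivation D) (α β : Γ) :
    coef₂ (dotD α) (coefL β) (D (L β)) = coef₂ (coefL α) (dotD β) (D (L α)) := by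
  obtain ⟨α₀, β₀, hb₀⟩ := exists_det_ne_zero hΓ
  have hB := (hD.isDetCocycle.exists_eq_coboundary hb₀).2
  by_cases h : α ≠ β
  · exact sub_eq_zero.1 (hB α β h)
  obtain rfl : α = β := not_not.1 h
  by_cases h0 : α = 0
  · simp [h0, L_zero]
  obtain ⟨β, hb⟩ := exists_det_ne_zero_of_ne_zero hΓ h0
  have hb' : det α β ≠ 0 := by rw [det_swap]; exact neg_ne_zero.2 hb
  have hb'' : det α (α + β) ≠ 0 := by rwa [det_add_right, det_self, zero_add]
  have n1 : α ≠ α + β := by intro h; rw [← h, det_self] at hb''; exact hb'' rfl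
  have n2 : α ≠ α + (α + β) := by
    intro h
    have : α + β = 0 := by simpa using h
    rw [this, det_zero_right] at hb''
    exact hb'' rfl
  have e1 := sub_eq_zero.1 (hB _ _ n1)
  have e2 := sub_eq_zero.1 (hB _ _ n2)
  have a0 := hD.coefD_add hb'' 0
  have a1 := hD.coefD_add hb'' 1
  have dot_add : ∀ μ ν : Γ, dotD (μ + ν) = dotD μ + dotD ν := by
    intro μ ν
    simp only [dotD, AddSubgroup.coe_add, Pi.add_apply, add_smul]
    abel
  rw [dot_add α (α + β), coef₂_add_right, LinearMap.add_apply, ← e1] at e2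
  simp only [dotD, coef₂_add_left, coef₂_smul_left, LinearMap.add_apply, LinearMap.smul_apply,
    smul_eq_mul] at e2 ⊢
  linear_combination e2 - (α : Fin 2 → ℂ) 0 * a0 - (α : Fin 2 → ℂ) 1 * a1

end IsDerivation

/-! ### Weight-zero elements and innerness of derivations -/

/-- The element `∑ c(γ) L_γ ⊗ L_{-γ} + ∑ aᵢⱼ ∂ᵢ ⊗ ∂ⱼ` of weight zero. -/
def weightZero (c : Γ →₀ ℂ) (a : Fin 2 → Fin 2 → ℂ) : GVir Γ ⊗[ℂ] GVir Γ :=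
  Finsupp.linearCombination ℂ (fun γ : Γ => L γ ⊗ₜ[ℂ] L (-γ)) c
    + ∑ i, ∑ j, a i j • ((d i : GVir Γ) ⊗ₜ[ℂ] (d j : GVir Γ))

theorem hasWeight_weightZero (c : Γ →₀ ℂ) (a : Fin 2 → Fin 2 → ℂ) :
    HasWeight (0 : Γ) (weightZero c a) := by
  intro i
  have h : ⁅(d i : GVir Γ), Finsupp.linearCombination ℂ (fun γ : Γ => L γ ⊗ₜ[ℂ] L (-γ)) c⁆
      = 0 := by
    induction c using Finsupp.induction_linear with
    | zero => simp
    | add x y hx hy => rw [map_add, lie_add, hx, hy, add_zero]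
    | single γ t =>
      simp [lie_d_L, ← TensorProduct.smul_tmul', TensorProduct.tmul_neg]
  simp [weightZero, lie_add, h, lie_d_d]

theorem coef₂_weightZero_L (c : Γ →₀ ℂ) (a : Fin 2 → Fin 2 → ℂ) {γ δ : Γ} (h : γ + δ = 0) :
    coef₂ (coefL γ) (coefL δ) (weightZero c a) = if γ = 0 then 0 else c γ := by
  obtain rfl : δ = -γ := eq_neg_of_add_eq_zero_right h
  rw [weightZero, map_add, map_sum]
  simp only [map_sum, map_smul, coef₂_tmul, coefL_d, zero_mul, smul_zero, Finset.sum_const_zero,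
    add_zero]
  by_cases h0 : γ = 0
  · simp [h0, coefL_zero, coef₂_zero_left]
  rw [if_neg h0]
  induction c using Finsupp.induction_linear with
  | zero => simp
  | add x y hx hy => rw [map_add, map_add, hx, hy, Finsupp.add_apply]
  | single α t =>
    rw [Finsupp.linearCombination_single, map_smul, coef₂_tmul, smul_eq_mul]
    by_cases h1 : α = γ
    · subst h1
      rw [coefL_L_self h0, coefL_L_self (neg_ne_zero.2 h0), Finsupp.single_eq_same]
      ring
    · rw [coefL_L_of_ne h1, Finsupp.single_eq_of_ne (Ne.symm h1)]
      ring

theorem coef₂_weightZero_d (c : Γ →₀ ℂ) (a : Fin 2 → Fin 2 → ℂ) (i j : Fin 2) :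
    coef₂ (coefD i) (coefD j) (weightZero c a) = a i j := by
  have h : coef₂ (coefD i) (coefD j)
      (Finsupp.linearCombination ℂ (fun γ : Γ => L γ ⊗ₜ[ℂ] L (-γ)) c) = 0 := by
    induction c using Finsupp.induction_linear with
    | zero => simp
    | add x y hx hy => rw [map_add, map_add, hx, hy, add_zero]
    | single γ t => simp [coef₂_tmul, coefD_L]
  rw [weightZero, map_add, h, zero_add, map_sum]
  fin_cases i <;> fin_cases j <;> simp [coef₂_tmul, coefD_d]

theorem coef₂_weightZero_L_d (c : Γ →₀ ℂ) (a : Fin 2 → Fin 2 → ℂ) (γ : Γ) (j : Fin 2) :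
    coef₂ (coefL γ) (coefD j) (weightZero c a) = 0 := by
  by_cases h0 : γ = 0
  · rw [h0, coefL_zero, coef₂_zero_left]; rfl
  · exact (hasWeight_weightZero c a).coef₂_eq_zero (s := Sum.inl γ) (t := Sum.inr j)
      (by simpa [weight] using h0)

theorem coef₂_weightZero_d_L (c : Γ →₀ ℂ) (a : Fin 2 → Fin 2 → ℂ) (γ : Γ) (j : Fin 2) :
    coef₂ (coefD j) (coefL γ) (weightZero c a) = 0 := by
  by_cases h0 : γ = 0
  · rw [h0, coefL_zero, coef₂_zero_right]; rfl
  · exact (hasWeight_weightZero c a).coef₂_eq_zero (s := Sum.inr j) (t := Sum.inl γ)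
      (by simpa [weight] using h0)

/-- Two families of vectors paired symmetrically come from a single matrix. -/
theorem exists_matrix (hΓ : Nondegenerate Γ) {g h : Γ → Fin 2 → ℂ}
    (hgh : ∀ α β : Γ, (α : Fin 2 → ℂ) 0 * h β 0 + (α : Fin 2 → ℂ) 1 * h β 1
      = (β : Fin 2 → ℂ) 0 * g α 0 + (β : Fin 2 → ℂ) 1 * g α 1) :
    ∃ a : Fin 2 → Fin 2 → ℂ, ∀ α : Γ,
      (∀ j, g α j = -((α : Fin 2 → ℂ) 0 * a 0 j + (α : Fin 2 → ℂ) 1 * a 1 j)) ∧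
      ∀ i, h α i = -((α : Fin 2 → ℂ) 0 * a i 0 + (α : Fin 2 → ℂ) 1 * a i 1) := by
  obtain ⟨α, β, hb⟩ := exists_det_ne_zero hΓ
  -- Cramer's rule for the rows of `a`, from the values of `g` at `α` and `β`. The pairing then
  -- determines all of `h`, and in turn all of `g`.
  let A0 : Fin 2 → ℂ := fun j => -(β.1 1 * g α j - α.1 1 * g β j) / det α β
  let A1 : Fin 2 → ℂ := fun j => -(α.1 0 * g β j - β.1 0 * g α j) / det α β
  have hh : ∀ ν : Γ, h ν 0 = -(ν.1 0 * A0 0 + ν.1 1 * A0 1) ∧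
      h ν 1 = -(ν.1 0 * A1 0 + ν.1 1 * A1 1) := by
    intro ν
    have e1 := hgh α ν
    have e2 := hgh β ν
    constructor
    · refine mul_left_cancel₀ hb ?_
      simp only [A0]
      field_simp
      simp only [det]
      linear_combination β.1 1 * e1 - α.1 1 * e2
    · refine mul_left_cancel₀ hb ?_
      simp only [A1]
      field_simp
      simp only [det]
      linear_combination α.1 0 * e2 - β.1 0 * e1
  refine ⟨![A0, A1], fun μ => ⟨?_, ?_⟩⟩
  · have e1 := hgh μ α
    have e2 := hgh μ β
    rw [(hh α).1, (hh α).2] at e1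
    rw [(hh β).1, (hh β).2] at e2
    intro j
    fin_cases j
    · refine mul_left_cancel₀ hb ?_
      simp only [det, Fin.zero_eta, Matrix.cons_val_zero, Matrix.cons_val_one]
      linear_combination α.1 1 * e2 - β.1 1 * e1
    · refine mul_left_cancel₀ hb ?_
      simp only [det, Fin.mk_one, Matrix.cons_val_zero, Matrix.cons_val_one]
      linear_combination β.1 0 * e1 - α.1 0 * e2
  · intro i
    fin_cases i
    · exact (hh μ).1
    · exact (hh μ).2

namespace IsDerivation

variable {D : GVir Γ →ₗ[ℂ] GVir Γ ⊗[ℂ] GVir Γ}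

theorem exists_inner_of_weight_zero (hΓ : Nondegenerate Γ) (hD : IsDerivation D)
    (h0 : ∀ i, HasWeight (0 : Γ) (D (d i))) : ∃ u, D = LieBialg.coboundary u := by
  obtain ⟨hd, hL⟩ := hD.of_weight_zero hΓ h0
  obtain ⟨α₀, β₀, hb₀⟩ := exists_det_ne_zero hΓ
  obtain ⟨c, hc⟩ := (hD.isDetCocycle.exists_eq_coboundary hb₀).1
  obtain ⟨a, ha⟩ := exists_matrix hΓ
    (g := fun α j => coef₂ (coefL α) (coefD j) (D (L α)))
    (h := fun α i => coef₂ (coefD i) (coefL α) (D (L α))) (by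
      intro α β
      have e := hD.dotD_eq hΓ α β
      simpa [dotD, coef₂_add_left, coef₂_add_right, coef₂_smul_left, coef₂_smul_right] using e)
  have hu := hasWeight_weightZero c a
  refine ⟨weightZero c a, hom_ext (fun α hα => coef₂_ext fun s t => ?_) fun i => ?_⟩
  · rw [LieBialg.coboundary_apply]
    by_cases hst : weight s + weight t = α
    · rw [coef₂_lie]
      rcases s with γ | i <;> rcases t with δ | j
      · obtain rfl : δ = α - γ := eq_sub_of_add_eq' hst
        have e := hc α γ
        simp only [coef, Sum.elim_inl]
        rw [e]
        have z1 : coef₂ (dotD α) (coefL (α - γ)) (weightZero c a) = 0 := by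
          simp [dotD, coef₂_add_left, coef₂_smul_left, coef₂_weightZero_d_L]
        have z2 : coef₂ (coefL γ) (dotD α) (weightZero c a) = 0 := by
          simp [dotD, coef₂_add_right, coef₂_smul_right, coef₂_weightZero_L_d]
        rw [coefL_comp_ad, coefL_comp_ad, coef₂_sub_left, coef₂_sub_right, coef₂_smul_left,
          coef₂_smul_left, coef₂_smul_right, coef₂_smul_right]
        simp only [LinearMap.sub_apply, LinearMap.smul_apply, z1, z2, smul_eq_mul, mul_zero,
          sub_zero]
        rw [coef₂_weightZero_L _ _ (by abel), coef₂_weightZero_L _ _ (by abel), det_sub_right,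
          det_self]
        -- As `L_0 = 0`, the value `c 0` is invisible in `weightZero`. It would matter only at `γ =
        -- 0` and `γ = α`, where the factor `det α γ` is zero.
        by_cases h1 : γ = 0
        · simp [h1, det_zero_right]
        · by_cases h2 : γ = α
          · simp [h2, det_self]
          · rw [if_neg h1, if_neg (sub_ne_zero.2 h2)]
            ring
      · obtain rfl : γ = α := by simpa [weight] using hst
        simp only [coef, Sum.elim_inl, Sum.elim_inr]
        rw [(ha γ).1, coefD_comp_ad_L, coef₂_zero_right, coefL_comp_ad, det_self, if_pos rfl,
          coef₂_sub_left]
        simp [dotD, coef₂_add_left, coef₂_smul_left, coef₂_weightZero_d, coef₂_zero_left]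
      · obtain rfl : δ = α := by simpa [weight] using hst
        simp only [coef, Sum.elim_inl, Sum.elim_inr]
        rw [(ha δ).2, coefD_comp_ad_L, coef₂_zero_left, coefL_comp_ad, det_self, if_pos rfl,
          coef₂_sub_right]
        simp [dotD, coef₂_add_right, coef₂_smul_right, coef₂_weightZero_d, coef₂_zero_right]
      -- Coordinates on `∂ᵢ ⊗ ∂ⱼ` have weight zero, but `α ≠ 0`.
      · exact absurd (by simpa [weight] using hst.symm) hα
    · rw [(hL α).coef₂_eq_zero hst, (hu.lie_L α).coef₂_eq_zero hst]
  · rw [hd, LieBialg.coboundary_apply, hu i]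
    simp

/-- Every derivation from the generalized Virasoro-like algebra `L` to `L ⊗ L` is inner. -/
theorem exists_inner (hΓ : Nondegenerate Γ) (hD : IsDerivation D) :
    ∃ u, D = LieBialg.coboundary u := by
  obtain ⟨u, hu⟩ := hD.exists_weight_zero
  obtain ⟨v, hv⟩ := (hD.sub_coboundary u).exists_inner_of_weight_zero hΓ hu
  exact ⟨v + u, by rw [LieBialg.coboundary_add, ← hv, sub_add_cancel]⟩

end IsDerivation
end GVir

end

/-! ### The three assertions -/

theorem theorem1p3 (Γ : AddSubgroup (Fin 2 → ℂ)) (hΓ : Nondegenerate Γ) :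
    (∀ Δ : GVir Γ →ₗ[ℂ] GVir Γ ⊗[ℂ] GVir Γ, LieBialg.IsLieBialgebra Δ →
      ∃ r : GVir Γ ⊗[ℂ] GVir Γ, LieBialg.IsTriangular Δ r) ∧
    (∀ r : GVir Γ ⊗[ℂ] GVir Γ, LieBialg.CYBE r ↔ LieBialg.MYBE r) ∧
    Subsingleton (LieBialg.H1 (GVir Γ) (GVir Γ ⊗[ℂ] GVir Γ)) := by
  refine ⟨fun Δ hΔ => ?_, fun r => ?_, ?_⟩
  · obtain ⟨r, hr⟩ := GVir.IsDerivation.exists_inner hΓ (D := Δ) hΔ.compat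
    exact ⟨r, hΔ.isTriangular (GVir.eq_zero_of_invariant hΓ) (GVir.eq_zero_of_invariant hΓ) hr⟩
  · exact LieBialg.cybe_iff_mybe (GVir.eq_zero_of_central hΓ) (GVir.eq_zero_of_invariant hΓ) r
  · rw [Submodule.Quotient.subsingleton_iff, eq_top_iff]
    intro D _
    obtain ⟨u, hu⟩ := GVir.IsDerivation.exists_inner hΓ (D := D.toLinearMap) fun x y =>
      D.leibniz' x y
    exact ⟨u, LieDerivation.ext fun x => (LinearMap.congr_fun hu x).symm⟩
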